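/- Let $\mathcal H$ be a separable complex Hilbert space. A bounded real linear operator $R$ on $\mathcal H$ is written uniquely as $R=C+A$ with $C=\frac12(R-iRi)$ complex linear and $A=\frac12(R+iRi)$ antilinear. It is trace-class if $C$ and $A$ are compact and the singular numbers of both (the square roots of the eigenvalues of $C^*C$, respectively $A^*A$, with multiplicity) are summable, and $\|R\|_1=\|C\|_1+\|A\|_1$ is the sum of all these singular numbers. Let $\kappa$ be a unitary conjugation on $\mathcal H$ (an antilinear isometric bijection with $\kappa^2=I$); the complexification of $R$ is the complex linear operator $$R^{\mathbb C}=\begin{bmatrix} C & A\kappa\\ \kappa A & \kappa C\kappa\end{bmatrix}\quad\text{on } \mathcal H\oplus\mathcal H .$$ For a complex linear trace-class operator $T$, the determinant $\det(I+T)$ is the limit of $\det(I+F)$ as $F\to T$ in the trace norm through operators of finite rank, where $\det(I+F)$ is the determinant of the restriction of $I+F$ to the range of $F$. For $\lambda=re^{i\theta}\ne0$, the characteristic function of a real linear trace-class operator $R=C+A$ is $$\varphi(re^{i\theta})=\det\left[I-r^{-1}(e^{-i\theta}C+A)\right]^{\mathbb C}.$$ Let $R$ be a real linear trace-class operator on $\mathcal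 H$. Then $\varphi$ is well defined and continuous on $\mathbb C\setminus\{0\}$, and its zeros are exactly the nonzero eigenvalues of $R$, i.e. the $\lambda\neq0$ for which there is $x\ne0$ with $Rx=\lambda x$. Furthermore, let $R_n=C_n+A_n$ $(n\in\mathbb N)$ be finite rank real linear operators with $\|R_n-R\|_1\to0$. For each $n$ let $e^{(n)}_1,\dots,e^{(n)}_{d_n}$ be a finite orthonormal family whose complex linear span contains the range of $R_n$ (for instance an orthonormal basis of the complex linear span of the range, in which case $d_n$ is the rank of $R_n$), and let $$p_n(\lambda,\overline\lambda)=\det\begin{bmatrix} \mathbf C_n-\lambda & \mathbf B_n\\ \overline{\mathbf B_n} & \overline{\mathbf C_n-\lambda}\end{bmatrix},\qquad (\mathbf C_n)_{jk}=(C_ne^{(n)}_k,e^{(n)}_j),\quad (\mathbf B_n)_{jk}=(A_ne^{(n)}_k,e^{(n)}_j),$$ be the characteristic polynomial of $R_n$. Then for all $\lambda\ne0$ $$\varphi(\lambda)=\lim_{n\to\infty}\frac{p_n(\lambda,\overline\lambda)}{|\lambda|^{2d_n}} .$$ -/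

import Mathlib

open Filter Topology
open scoped ENNReal NNReal InnerProductSpace ComplexConjugate

noncomputable section

namespace RealLinear

variable {H : Type*} [NormedAddCommGroup H] [InnerProductSpace ℂ H]

/-! ### Complex linear and antilinear parts of a bounded real linear operator -/

/-- The complex linear part `C = (R - i R i) / 2` of a real linear operator `R`. -/
def linPart (R : H →L[ℝ] H) : H →L[ℂ] H where
  toFun x := (1 / 2 : ℂ) • (R x - Complex.I • R (Complex.I • x))
  map_add' x y := by simp only [smul_add, map_add]; module
  map_smul' c x := by
    have h : ∀ z : H, c • z = c.re • z + c.im • (Complex.I • z) := fun z => by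
      conv_lhs => rw [← Complex.re_add_im c]
      rw [add_smul, mul_smul, Complex.coe_smul, Complex.coe_smul]
    have hI : ∀ z : H, Complex.I • Complex.I • z = -z := fun z => by
      rw [smul_smul, Complex.I_mul_I, neg_one_smul]
    rw [RingHom.id_apply, h x, smul_add, smul_comm Complex.I c.re x,
      smul_comm Complex.I c.im (Complex.I • x), hI, h]
    simp only [map_add, map_smul, map_neg, smul_add, smul_neg, smul_sub,
      smul_comm Complex.I c.re, smul_comm Complex.I c.im, smul_comm (1 / 2 : ℂ) c.re,
      smul_comm (1 / 2 : ℂ) c.im, smul_comm (1 / 2 : ℂ) Complex.I, hI]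
    module
  cont := by fun_prop

/-- The antilinear part `A = (R + i R i) / 2` of a real linear operator `R`. -/
def antiPart (R : H →L[ℝ] H) : H →L⋆[ℂ] H where
  toFun x := (1 / 2 : ℂ) • (R x + Complex.I • R (Complex.I • x))
  map_add' x y := by simp only [smul_add, map_add]; module
  map_smul' c x := by
    have h : ∀ (c : ℂ) (z : H), c • z = c.re • z + c.im • (Complex.I • z) := fun c z => by
      conv_lhs => rw [← Complex.re_add_im c]
      rw [add_smul, mul_smul, Complex.coe_smul, Complex.coe_smul]
    have hI : ∀ z : H, Complex.I • Complex.I • z = -z := fun z => by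
      rw [smul_smul, Complex.I_mul_I, neg_one_smul]
    rw [h (conj c), Complex.conj_re, Complex.conj_im, h c x]
    rw [smul_add Complex.I, smul_comm Complex.I c.re x, smul_comm Complex.I c.im (Complex.I • x), hI]
    simp only [map_add, map_smul, map_neg, smul_add, smul_neg,
      smul_comm Complex.I c.re, smul_comm Complex.I c.im, smul_comm (1 / 2 : ℂ) c.re,
      smul_comm (1 / 2 : ℂ) c.im, smul_comm (1 / 2 : ℂ) Complex.I, hI]
    module
  cont := by fun_prop

/-- The real linear operator `c C + A`, where `C` and `A` are the complex linear and the
antilinear part of `R`. -/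
def scaleLinPart (c : ℂ) (R : H →L[ℝ] H) : H →L[ℝ] H where
  toFun x := c • linPart R x + antiPart R x
  map_add' x y := by simp only [map_add, smul_add]; abel
  map_smul' r x := by
    rw [← Complex.coe_smul r x, map_smul, ContinuousLinearMap.map_smulₛₗ, Complex.conj_ofReal,
      RingHom.id_apply, smul_comm c, ← smul_add, Complex.coe_smul]
  cont := by fun_prop

/-! ### Complexification -/

/-- The complexification of `R = C + A` with respect to a conjugation `κ`: the complex linear
operator on the Hilbert space `H ⊕ H` with block matrix `[[C, A κ], [κ A, κ C κ]]`. -/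
def complexification (κ : H ≃ₗᵢ⋆[ℂ] H) (R : H →L[ℝ] H) :
    WithLp 2 (H × H) →L[ℂ] WithLp 2 (H × H) :=
  let C : H →L[ℂ] H := linPart R
  let A : H →L⋆[ℂ] H := antiPart R
  let k : H →L⋆[ℂ] H := (κ.toContinuousLinearEquiv : H →L⋆[ℂ] H)
  let e := WithLp.prodContinuousLinearEquiv 2 ℂ H H
  ((e.symm : (H × H) →L[ℂ] WithLp 2 (H × H)).comp
    ((C.coprod (A.comp k)).prod ((k.comp A).coprod (k.comp (C.comp k))))).comp
      (e : WithLp 2 (H × H) →L[ℂ] H × H)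

/-! ### Singular numbers and trace norms -/

/-- For a positive operator `P` (to be used with `P = T* T`), the sum of all `s > 0` such that
`s ^ 2` is an eigenvalue of `P`, each repeated according to its multiplicity. -/
def sumSingularNumbers {K : Type*} [NormedAddCommGroup K] [InnerProductSpace ℂ K]
    (P : K →L[ℂ] K) : ℝ≥0∞ :=
  ∑' s : ℝ≥0, (Module.finrank ℂ
    (Module.End.eigenspace (P : K →ₗ[ℂ] K) (((s : ℝ) : ℂ) ^ 2)) : ℝ≥0∞) * (s : ℝ≥0∞)

variable [CompleteSpace H]

open Classical in
/-- The trace norm (Schatten `1`-norm) of a complex linear operator; it is `∞` when the operator is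
not in the trace class, in particular when it is not compact. -/
def traceNorm {K : Type*} [NormedAddCommGroup K] [InnerProductSpace ℂ K] [CompleteSpace K]
    (T : K →L[ℂ] K) : ℝ≥0∞ :=
  if IsCompactOperator T then
    sumSingularNumbers ((ContinuousLinearMap.adjoint T).comp T) else ⊤

/-- The adjoint `A*` of an antilinear operator `A`, see `inner_antiAdjoint`. -/
def antiAdjoint (A : H →L⋆[ℂ] H) : H →L⋆[ℂ] H where
  toFun x := (InnerProductSpace.toDual ℂ H).symm (((innerSL ℂ).flip x).comp A)
  map_add' x y := by
    refine ext_inner_right ℂ fun v => ?_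
    simp [inner_add_left, InnerProductSpace.toDual_symm_apply]
  map_smul' c x := by
    refine ext_inner_right ℂ fun v => ?_
    simp [inner_smul_left, InnerProductSpace.toDual_symm_apply]
  cont := by
    refine (InnerProductSpace.toDual ℂ H).symm.continuous.comp ?_
    exact ((ContinuousLinearMap.compSL H H ℂ (starRingEnd ℂ) (starRingEnd ℂ)).flip A).continuous.comp
      (innerSL ℂ (E := H)).flip.continuous

theorem inner_antiAdjoint (A : H →L⋆[ℂ] H) (x y : H) :
    ⟪antiAdjoint A x, y⟫_ℂ = ⟪A y, x⟫_ℂ := by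
  simp [antiAdjoint, InnerProductSpace.toDual_symm_apply]

open Classical in
/-- The trace norm of an antilinear operator; it is `∞` when the operator is not in the trace
class. -/
def antiTraceNorm (A : H →L⋆[ℂ] H) : ℝ≥0∞ :=
  if IsCompactOperator A then sumSingularNumbers ((antiAdjoint A).comp A) else ⊤

/-- The trace norm `‖R‖₁ = ‖C‖₁ + ‖A‖₁` of a real linear operator `R = C + A`. -/
def realTraceNorm (R : H →L[ℝ] H) : ℝ≥0∞ :=
  traceNorm (linPart R) + antiTraceNorm (antiPart R)

/-- `R = C + A` is trace-class: `C` and `A` are compact with summable singular numbers. -/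
def IsTraceClass (R : H →L[ℝ] H) : Prop :=
  realTraceNorm R < ∞

/-! ### Determinants of perturbations of the identity -/

section FredholmDeterminant

variable {K : Type*} [NormedAddCommGroup K] [InnerProductSpace ℂ K]

/-- `det (I + F)` for an operator `F` of finite rank: the determinant of the restriction of
`I + F` to the range of `F`. -/
def detOneAdd (F : K →L[ℂ] K) : ℂ :=
  LinearMap.det
    ((1 : Module.End ℂ (F : K →ₗ[ℂ] K).range) +
      (F : K →ₗ[ℂ] K).rangeRestrict ∘ₗ (F : K →ₗ[ℂ] K).range.subtype)

variable [CompleteSpace K]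

/-- The filter of finite rank operators `F` tending to `T` in the trace norm. -/
def finiteRankApprox (T : K →L[ℂ] K) : Filter (K →L[ℂ] K) :=
  comap (fun F => traceNorm (F - T)) (𝓝 0) ⊓
    𝓟 {F | FiniteDimensional ℂ (F : K →ₗ[ℂ] K).range}

/-- `d` is the Fredholm determinant `det S` of `S = I + T`: the operator `T` is a trace norm limit
of operators `F` of finite rank, and `det (I + F) → d` as `F → T` in the trace norm. -/
def HasFredholmDet (S : K →L[ℂ] K) (d : ℂ) : Prop :=
  (finiteRankApprox (S - 1)).NeBot ∧ Tendsto detOneAdd (finiteRankApprox (S - 1)) (𝓝 d)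

open Classical in
/-- The Fredholm determinant of `S`, with the default value `0` when it does not exist. -/
def fredholmDet (S : K →L[ℂ] K) : ℂ :=
  if h : ∃ d, HasFredholmDet S d then h.choose else 0

end FredholmDeterminant

/-! ### Characteristic function and characteristic polynomial -/

/-- The operator `[I - r⁻¹ (e^{-iθ} C + A)]^ℂ` for `l = r e^{iθ}` and `R = C + A`. -/
def charOperator (κ : H ≃ₗᵢ⋆[ℂ] H) (R : H →L[ℝ] H) (l : ℂ) :
    WithLp 2 (H × H) →L[ℂ] WithLp 2 (H × H) :=
  complexification κ
    (ContinuousLinearMap.id ℝ H -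
      ‖l‖⁻¹ • scaleLinPart (Complex.exp (-((l.arg : ℂ) * Complex.I))) R)

/-- The characteristic function `φ (r e^{iθ}) = det [I - r⁻¹ (e^{-iθ} C + A)]^ℂ` of `R = C + A`. -/
def charFun (κ : H ≃ₗᵢ⋆[ℂ] H) (R : H →L[ℝ] H) (l : ℂ) : ℂ :=
  fredholmDet (charOperator κ R l)

/-- The value `p (l, conj l) = det [[C - l, B], [conj B, conj (C - l)]]` of the characteristic
polynomial of a finite rank operator with matrix representation `C + B τ` with respect to the
orthonormal family `e`; here `τ` is componentwise complex conjugation. -/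
def charPoly {d : ℕ} (R : H →L[ℝ] H) (e : Fin d → H) (l : ℂ) : ℂ :=
  let C : Matrix (Fin d) (Fin d) ℂ := Matrix.of fun i j => ⟪e i, linPart R (e j)⟫_ℂ
  let B : Matrix (Fin d) (Fin d) ℂ := Matrix.of fun i j => ⟪e i, antiPart R (e j)⟫_ℂ
  (Matrix.fromBlocks (C - Matrix.scalar (Fin d) l) B
    (B.map conj) ((C - Matrix.scalar (Fin d) l).map conj)).det

end RealLinear

end

/-! The trace norm, defined through eigenvalues of `T*T`, has no evident triangle inequality, so the
analysis runs on `dualTraceNorm`. For compact `T` the two agree (`traceNorm_eq_dualTraceNorm`), by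
testing on a Hilbert basis of eigenvectors of `T*T`.

Hadamard's inequality in a basis of singular vectors gives `|det (I + F)| ≤ exp ‖F‖₁` for finite
rank `F`. Since `z ↦ det (I + F + z (G - F))` is a polynomial, the Schwarz lemma on a disc of radius
about `1 / ‖G - F‖₁` turns this bound into a local Lipschitz estimate (`dist_detOneAdd_le`). Hence
the Fredholm determinant exists and is continuous in the trace norm.

It vanishes exactly when `S` has a kernel. A kernel vector of `S` becomes one of `I + F` after a
small rank-one change of `F`. If `S` is injective, the Fredholm alternative bounds `S`, hence every
close `I + F`, from below; Hadamard's inequality for the inverse then keeps `det (I + F)` away from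
`0`.

For the characteristic function, `r⁻¹ e^{-iθ} = l⁻¹`, so the operator depends on `l` only through
`l⁻¹` and `‖l‖⁻¹`. A kernel vector of the complexification yields a fixed vector of `l⁻¹ C + ‖l‖⁻¹
A`, and a unimodular square root of `l / ‖l‖` turns that into an eigenvector of `R`. For finite
rank, the normalised characteristic polynomial equals the determinant of the complexified operator
(`charPoly_eq_detOneAdd`), so the limit formula is the definition of the Fredholm determinant along
one sequence. -/

noncomputable section

/-! ### Determinants in finite dimension -/

namespace LinearMap

/-- The **Weinstein–Aronszajn identity** for linear maps. -/
theorem det_one_add_comp_comm {k U V : Type*} [Field k] [AddCommGroup U] [Module k U]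
    [AddCommGroup V] [Module k V] [FiniteDimensional k U] [FiniteDimensional k V]
    (B : U →ₗ[k] V) (D : V →ₗ[k] U) :
    LinearMap.det (1 + B ∘ₗ D) = LinearMap.det (1 + D ∘ₗ B) := by
  classical
  let b := Module.finBasis k U
  let c := Module.finBasis k V
  rw [← LinearMap.det_toMatrix c, ← LinearMap.det_toMatrix b, map_add, map_add,
    LinearMap.toMatrix_comp c b c, LinearMap.toMatrix_comp b c b, LinearMap.toMatrix_one,
    LinearMap.toMatrix_one, Matrix.det_one_add_mul_comm]

/-- **Hadamard's inequality**. -/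
theorem norm_det_le_prod_norm {ι V : Type*} [Fintype ι] [NormedAddCommGroup V]
    [InnerProductSpace ℂ V] (b : OrthonormalBasis ι ℂ V) (f : V →ₗ[ℂ] V) :
    ‖LinearMap.det f‖ ≤ ∏ i, ‖f (b i)‖ := by
  classical
  obtain ⟨e⟩ : Nonempty (ι ≃ Fin (Fintype.card ι)) := ⟨Fintype.equivFin ι⟩
  let b' := b.reindex e
  have hfin : FiniteDimensional ℂ V := b.toBasis.finiteDimensional_of_finite
  have h : Module.finrank ℂ V = Fintype.card (Fin (Fintype.card ι)) := by
    rw [Fintype.card_fin, Module.finrank_eq_card_basis b.toBasis]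
  let v : Fin (Fintype.card ι) → V := fun i => f (b' i)
  let c := InnerProductSpace.gramSchmidtOrthonormalBasis h v
  -- In the Gram–Schmidt basis of the images the matrix is triangular, and the change between
  -- orthonormal bases has determinant of modulus one.
  have h1 : c.toBasis.det v = LinearMap.det f * c.toBasis.det b' := by
    rw [← Module.Basis.det_comp]; rfl
  have h2 : ‖LinearMap.det f‖ = ∏ i, ‖⟪c i, v i⟫_ℂ‖ := by
    have := congrArg norm h1
    rw [norm_mul, OrthonormalBasis.det_to_matrix_orthonormalBasis, mul_one] at this
    rw [← this, InnerProductSpace.gramSchmidtOrthonormalBasis_det, norm_prod]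
  rw [h2, ← e.symm.prod_comp]
  refine Finset.prod_le_prod (fun _ _ => norm_nonneg _) fun i _ => ?_
  refine (norm_inner_le_norm _ _).trans ?_
  rw [c.orthonormal.1 i, one_mul]
  simp [v, b']

end LinearMap

/-! ### Finite rank determinants through factorisations -/

namespace RealLinear

variable {K : Type*} [NormedAddCommGroup K] [InnerProductSpace ℂ K]

/-- The Weinstein–Aronszajn identity is used twice: from the range of `F` to the larger range of
`B`, then from there to `U`. Thus any convenient finite-dimensional space can carry the determinant.
-/
theorem detOneAdd_eq_det_of_factor {U : Type*} [AddCommGroup U] [Module ℂ U]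
    [FiniteDimensional ℂ U] (F : K →L[ℂ] K) (B : U →ₗ[ℂ] K) (D : K →ₗ[ℂ] U)
    (h : ∀ x, F x = B (D x)) : detOneAdd F = LinearMap.det (1 + D ∘ₗ B) := by
  have hle : (F : K →ₗ[ℂ] K).range ≤ B.range := by
    rintro _ ⟨x, rfl⟩
    exact ⟨D x, (h x).symm⟩
  have : FiniteDimensional ℂ (F : K →ₗ[ℂ] K).range := Submodule.finiteDimensional_of_le hle
  have h1 := LinearMap.det_one_add_comp_comm B.rangeRestrict (D ∘ₗ B.range.subtype)
  have h2 := LinearMap.det_one_add_comp_comm (Submodule.inclusion hle)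
    ((F : K →ₗ[ℂ] K).rangeRestrict ∘ₗ B.range.subtype)
  calc detOneAdd F = _ := h2.symm
    _ = _ := by
      rw [← LinearMap.comp_assoc]
      congr 2
      ext x
      simp [h]
    _ = _ := h1

theorem detOneAdd_eq_det_restrict (F : K →L[ℂ] K) (V : Submodule ℂ K) [FiniteDimensional ℂ V]
    (h : ∀ x, F x ∈ V) :
    detOneAdd F = LinearMap.det ((1 : Module.End ℂ V) +
      (F : K →ₗ[ℂ] K).codRestrict V h ∘ₗ V.subtype) :=
  detOneAdd_eq_det_of_factor F V.subtype _ fun _ => rfl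

end RealLinear

/-- Cauchy–Schwarz for the sum, then Bessel's inequality in each factor. -/
theorem Orthonormal.sum_enorm_inner_mul_enorm_inner_le {H K ι : Type*} [Fintype ι]
    [NormedAddCommGroup H] [InnerProductSpace ℂ H] [NormedAddCommGroup K] [InnerProductSpace ℂ K]
    {u : ι → H} {v : ι → K} (hu : Orthonormal ℂ u) (hv : Orthonormal ℂ v) (a : H) (b : K) :
    ∑ i, ‖⟪u i, a⟫_ℂ‖ₑ * ‖⟪v i, b⟫_ℂ‖ₑ ≤ ‖a‖ₑ * ‖b‖ₑ := by
  have h : ∑ i, ‖⟪u i, a⟫_ℂ‖ * ‖⟪v i, b⟫_ℂ‖ ≤ ‖a‖ * ‖b‖ := by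
    refine (Real.sum_mul_le_sqrt_mul_sqrt _ _ _).trans ?_
    gcongr
    · exact Real.sqrt_le_iff.2 ⟨norm_nonneg _, hu.sum_inner_products_le a⟩
    · exact Real.sqrt_le_iff.2 ⟨norm_nonneg _, hv.sum_inner_products_le b⟩
  simp only [← ofReal_norm, ← ENNReal.ofReal_mul (norm_nonneg _)]
  rw [← ENNReal.ofReal_sum_of_nonneg fun _ _ => by positivity]
  exact ENNReal.ofReal_le_ofReal h

namespace RealLinear

/-! ### The trace norm by duality -/

section DualTraceNorm

variable {K : Type*} [NormedAddCommGroup K] [InnerProductSpace ℂ K]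

/-- The supremum of `∑ i, |⟪u i, T (v i)⟫|` over all pairs of finite orthonormal families. -/
def dualTraceNorm (T : K →L[ℂ] K) : ℝ≥0∞ :=
  ⨆ (n : ℕ) (u : Fin n → K) (v : Fin n → K) (_ : Orthonormal ℂ u) (_ : Orthonormal ℂ v),
    ∑ i, ‖⟪u i, T (v i)⟫_ℂ‖ₑ

theorem sum_le_dualTraceNorm {ι : Type*} [Fintype ι] (T : K →L[ℂ] K) {u v : ι → K}
    (hu : Orthonormal ℂ u) (hv : Orthonormal ℂ v) :
    ∑ i, ‖⟪u i, T (v i)⟫_ℂ‖ₑ ≤ dualTraceNorm T := by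
  let e := Fintype.equivFin ι
  rw [← e.symm.sum_comp]
  exact le_iSup_of_le _ (le_iSup_of_le (u ∘ e.symm) (le_iSup_of_le (v ∘ e.symm)
    (le_iSup_of_le (hu.comp _ e.symm.injective)
      (le_iSup_of_le (hv.comp _ e.symm.injective) le_rfl))))

theorem dualTraceNorm_le {T : K →L[ℂ] K} {c : ℝ≥0∞}
    (h : ∀ (n : ℕ) (u v : Fin n → K), Orthonormal ℂ u → Orthonormal ℂ v →
      ∑ i, ‖⟪u i, T (v i)⟫_ℂ‖ₑ ≤ c) : dualTraceNorm T ≤ c :=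
  iSup_le fun n => iSup_le fun u => iSup_le fun v => iSup_le fun hu => iSup_le fun hv =>
    h n u v hu hv

theorem dualTraceNorm_add_le (S T : K →L[ℂ] K) :
    dualTraceNorm (S + T) ≤ dualTraceNorm S + dualTraceNorm T := by
  refine dualTraceNorm_le fun n u v hu hv => ?_
  refine le_trans ?_ (add_le_add (sum_le_dualTraceNorm S hu hv) (sum_le_dualTraceNorm T hu hv))
  rw [← Finset.sum_add_distrib]
  refine Finset.sum_le_sum fun i _ => ?_
  rw [add_apply, inner_add_right]
  exact enorm_add_le _ _

theorem dualTraceNorm_smul_le (c : ℂ) (T : K →L[ℂ] K) :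
    dualTraceNorm (c • T) ≤ ‖c‖ₑ * dualTraceNorm T := by
  refine dualTraceNorm_le fun n u v hu hv => ?_
  refine le_trans ?_ (mul_le_mul_right (sum_le_dualTraceNorm T hu hv) _)
  rw [Finset.mul_sum]
  refine Finset.sum_le_sum fun i _ => ?_
  rw [smul_apply, inner_smul_right, enorm_mul]

theorem dualTraceNorm_neg (T : K →L[ℂ] K) : dualTraceNorm (-T) = dualTraceNorm T := by
  simp [dualTraceNorm]

theorem dualTraceNorm_sub_comm (S T : K →L[ℂ] K) :
    dualTraceNorm (S - T) = dualTraceNorm (T - S) := by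
  rw [← neg_sub, dualTraceNorm_neg]

theorem dualTraceNorm_sub_le (S T : K →L[ℂ] K) :
    dualTraceNorm (S - T) ≤ dualTraceNorm S + dualTraceNorm T := by
  rw [sub_eq_add_neg, ← dualTraceNorm_neg T]
  exact dualTraceNorm_add_le _ _

theorem dualTraceNorm_rankOne_le (a b : K) :
    dualTraceNorm ((innerSL ℂ a).smulRight b) ≤ ‖a‖ₑ * ‖b‖ₑ := by
  refine dualTraceNorm_le fun n u v hu hv => ?_
  refine le_trans (Finset.sum_le_sum fun i _ => ?_) (hv.sum_enorm_inner_mul_enorm_inner_le hu a b)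
  rw [ContinuousLinearMap.smulRight_apply, inner_smul_right, enorm_mul, innerSL_apply_apply,
    ← inner_conj_symm, RCLike.enorm_conj]

/-- If the images of an orthonormal family are orthogonal, the sum of their norms is bounded
by the trace norm. -/
theorem tsum_enorm_le_dualTraceNorm {ι : Type*} (T : K →L[ℂ] K) {v : ι → K}
    (hv : Orthonormal ℂ v) (h : Pairwise fun i j => ⟪T (v i), T (v j)⟫_ℂ = 0) :
    ∑' i, ‖T (v i)‖ₑ ≤ dualTraceNorm T := by
  classical
  rw [ENNReal.tsum_eq_iSup_sum]
  refine iSup_le fun s => ?_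
  -- Indices with vanishing image add nothing to the sum; without them the images can be normalised
  -- to an orthonormal family.
  let t := s.filter fun i => T (v i) ≠ 0
  have hts : ∑ i ∈ s, ‖T (v i)‖ₑ = ∑ i ∈ t, ‖T (v i)‖ₑ := by
    rw [Finset.sum_filter_of_ne]
    intro i _ hi h0
    simp [h0] at hi
  have hne : ∀ i : t, ‖T (v i)‖ ≠ 0 := fun i => norm_ne_zero_iff.2 (Finset.mem_filter.1 i.2).2
  let u : t → K := fun i => ((‖T (v i)‖⁻¹ : ℝ) : ℂ) • T (v i)
  have hu : Orthonormal ℂ u := by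
    refine ⟨fun i => ?_, fun i j hij => ?_⟩
    · simp only [u, norm_smul, Complex.norm_real, norm_inv, norm_norm]
      exact inv_mul_cancel₀ (hne i)
    · simp only [u, inner_smul_left, inner_smul_right]
      rw [h (fun h => hij (Subtype.ext h)), mul_zero, mul_zero]
  rw [hts, ← Finset.sum_coe_sort]
  refine le_trans (le_of_eq ?_)
    (sum_le_dualTraceNorm T hu (hv.comp _ (Subtype.val_injective (p := (· ∈ t)))))
  refine Finset.sum_congr rfl fun i _ => ?_
  rw [← ofReal_norm, ← ofReal_norm]
  congr 1
  simp only [u, inner_smul_left, Function.comp_apply, inner_self_eq_norm_sq_to_K, norm_mul,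
    RCLike.norm_conj, Complex.norm_real, norm_inv, norm_norm, norm_pow, Complex.coe_algebraMap]
  have := hne i
  field_simp

/-- A one-element orthonormal family, the normalised `x`, already detects the operator norm. -/
theorem enorm_apply_le_dualTraceNorm (T : K →L[ℂ] K) (x : K) :
    ‖T x‖ₑ ≤ dualTraceNorm T * ‖x‖ₑ := by
  rcases eq_or_ne x 0 with rfl | hx
  · simp
  have hx' : ‖x‖ ≠ 0 := norm_ne_zero_iff.2 hx
  let v : Unit → K := fun _ => ((‖x‖⁻¹ : ℝ) : ℂ) • x
  have hv : Orthonormal ℂ v :=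
    ⟨fun _ => by simp [v, norm_smul, hx'], fun i j hij => (hij (Subsingleton.elim i j)).elim⟩
  have h := tsum_enorm_le_dualTraceNorm T hv fun i j hij => (hij (Subsingleton.elim i j)).elim
  rw [tsum_fintype, Fintype.sum_unique] at h
  have h2 : T x = (‖x‖ : ℂ) • T (v default) := by
    simp only [v, map_smul, smul_smul, ← Complex.ofReal_mul, mul_inv_cancel₀ hx',
      Complex.ofReal_one, one_smul]
  have h3 : ‖(‖x‖ : ℂ)‖ₑ = ‖x‖ₑ := by
    rw [← ofReal_norm, ← ofReal_norm, Complex.norm_real, norm_norm]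
  rw [h2, enorm_smul, h3, mul_comm]
  gcongr

theorem norm_apply_le_dualTraceNorm {T : K →L[ℂ] K} (hT : dualTraceNorm T ≠ ∞) (x : K) :
    ‖T x‖ ≤ (dualTraceNorm T).toReal * ‖x‖ := by
  have h := enorm_apply_le_dualTraceNorm T x
  rw [← toReal_enorm, ← toReal_enorm, ← ENNReal.toReal_mul]
  exact ENNReal.toReal_mono (ENNReal.mul_ne_top hT enorm_ne_top) h

/-- Expanding `D (v i)` in the basis `w` and interchanging the sums leaves, for each `k`, a sum over
`i` controlled by Bessel's inequality for `D* (w k)` and `B (S (w k))`. This gives the ideal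
property, also between different Hilbert spaces. -/
theorem dualTraceNorm_comp_comp_le {H ι : Type*} [NormedAddCommGroup H] [InnerProductSpace ℂ H]
    [CompleteSpace H] [CompleteSpace K] (w : HilbertBasis ι ℂ H) (S : H →L[ℂ] H)
    (B : H →L[ℂ] K) (D : K →L[ℂ] H) :
    dualTraceNorm (B.comp (S.comp D)) ≤ ‖D‖ₑ * ‖B‖ₑ * ∑' k, ‖S (w k)‖ₑ := by
  refine dualTraceNorm_le fun n u v hu hv => ?_
  have h1 : ∀ i, ‖⟪u i, B.comp (S.comp D) (v i)⟫_ℂ‖ₑ ≤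
      ∑' k, ‖⟪v i, D.adjoint (w k)⟫_ℂ‖ₑ * ‖⟪u i, B (S (w k))⟫_ℂ‖ₑ := by
    intro i
    have hs := ((innerSL ℂ (u i)).comp (B.comp S)).hasSum (w.hasSum_repr (D (v i)))
    simp only [map_smul, w.repr_apply_apply, ContinuousLinearMap.comp_apply, smul_eq_mul,
      innerSL_apply_apply] at hs
    rw [ContinuousLinearMap.comp_apply, ContinuousLinearMap.comp_apply, ← hs.tsum_eq]
    refine (enorm_tsum_le_tsum_enorm).trans (ENNReal.tsum_le_tsum fun k => ?_)
    rw [enorm_mul, ContinuousLinearMap.adjoint_inner_right, ← inner_conj_symm,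
      RCLike.enorm_conj]
  refine (Finset.sum_le_sum fun i _ => h1 i).trans ?_
  rw [← tsum_fintype (L := .unconditional _), ENNReal.tsum_comm, ← ENNReal.tsum_mul_left]
  refine ENNReal.tsum_le_tsum fun k => ?_
  rw [tsum_fintype]
  refine (hv.sum_enorm_inner_mul_enorm_inner_le hu _ _).trans ?_
  have h2 : ‖D.adjoint (w k)‖ₑ ≤ ‖D‖ₑ := by
    have := D.adjoint.le_opENorm (w k)
    have hw : ‖w k‖ₑ = 1 := by
      rw [← ofReal_norm, w.orthonormal.1 k, ENNReal.ofReal_one]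
    have hD : ‖D.adjoint‖ₑ = ‖D‖ₑ := by
      rw [← ofReal_norm, ← ofReal_norm, LinearIsometryEquiv.norm_map]
    rwa [hw, mul_one, hD] at this
  rw [mul_assoc]
  exact mul_le_mul' h2 (B.le_opENorm _)

theorem dualTraceNorm_le_tsum {ι : Type*} [CompleteSpace K] (w : HilbertBasis ι ℂ K)
    (T : K →L[ℂ] K) : dualTraceNorm T ≤ ∑' k, ‖T (w k)‖ₑ := by
  refine (dualTraceNorm_comp_comp_le w T (.id ℂ K) (.id ℂ K)).trans ?_
  have h : ‖ContinuousLinearMap.id ℂ K‖ₑ ≤ 1 := by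
    rw [← ofReal_norm]
    exact ENNReal.ofReal_le_one.2 ContinuousLinearMap.norm_id_le
  calc _ ≤ 1 * 1 * ∑' k, ‖T (w k)‖ₑ := by gcongr
    _ = _ := by rw [one_mul, one_mul]

end DualTraceNorm

theorem isCompactOperator_of_finiteDimensional_range {K : Type*} [NormedAddCommGroup K]
    [InnerProductSpace ℂ K] (F : K →L[ℂ] K)
    [FiniteDimensional ℂ (F : K →ₗ[ℂ] K).range] : IsCompactOperator F :=
  (isCompactOperator_of_locallyCompactSpace_rng (F : K →ₗ[ℂ] K).range.subtypeL).comp_clm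
    F.rangeRestrict

/-! ### Singular vectors and equality of the two trace norms -/

section SingularBasis

universe u

variable {K : Type u} [NormedAddCommGroup K] [InnerProductSpace ℂ K] [CompleteSpace K]

theorem inner_adjoint_comp_self (T : K →L[ℂ] K) (x y : K) :
    ⟪x, ((ContinuousLinearMap.adjoint T).comp T) y⟫_ℂ = ⟪T x, T y⟫_ℂ := by
  rw [ContinuousLinearMap.comp_apply, ContinuousLinearMap.adjoint_inner_right]

theorem isSymmetric_adjoint_comp_self (T : K →L[ℂ] K) :
    ((ContinuousLinearMap.adjoint T).comp T : K →L[ℂ] K).IsSymmetric := fun x y => by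
  change ⟪((ContinuousLinearMap.adjoint T).comp T) x, y⟫_ℂ =
    ⟪x, ((ContinuousLinearMap.adjoint T).comp T) y⟫_ℂ
  rw [inner_adjoint_comp_self, ContinuousLinearMap.comp_apply,
    ContinuousLinearMap.adjoint_inner_left]

theorem inner_apply_eigenvector {T : K →L[ℂ] K} {m : ℂ} {x y : K}
    (hy : y ∈ Module.End.eigenspace
      (((ContinuousLinearMap.adjoint T).comp T : K →L[ℂ] K) : K →ₗ[ℂ] K) m) :
    ⟪T x, T y⟫_ℂ = m * ⟪x, y⟫_ℂ := by
  rw [← inner_adjoint_comp_self, ← inner_smul_right]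
  exact congrArg _ (Module.End.mem_eigenspace_iff.1 hy)

theorem eigenvalue_adjoint_comp_self {T : K →L[ℂ] K} {m : ℂ} {x : K} (hx : ‖x‖ = 1)
    (hm : x ∈ Module.End.eigenspace
      (((ContinuousLinearMap.adjoint T).comp T : K →L[ℂ] K) : K →ₗ[ℂ] K) m) :
    m = ((‖T x‖₊ : ℝ) : ℂ) ^ 2 := by
  have h := inner_apply_eigenvector (T := T) (x := x) hm
  rw [inner_self_eq_norm_sq_to_K, inner_self_eq_norm_sq_to_K, hx] at h
  simpa using h.symm

/-- Eigenspaces of `T*T` are indexed by singular numbers; injectivity ensures that no eigenspace is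
listed twice. -/
theorem injective_coe_sq : Function.Injective fun s : ℝ≥0 => ((s : ℝ) : ℂ) ^ 2 := by
  intro s t h
  have h' : (s : ℝ) ^ 2 = (t : ℝ) ^ 2 := Complex.ofReal_injective (by simpa using h)
  exact NNReal.coe_injective ((pow_left_inj₀ s.2 t.2 two_ne_zero).1 h')

/-- A compact self-adjoint operator has a Hilbert basis that consists of Hilbert bases of its
eigenspaces. -/
theorem exists_hilbertBasis_eigenspaces {α : Type} {f : α → ℂ} (hf : Function.Injective f)
    {P : K →L[ℂ] K} (hP : IsCompactOperator P) (hsymm : P.IsSymmetric)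
    (h : ∀ m, Module.End.eigenspace (P : K →ₗ[ℂ] K) m ≠ ⊥ → ∃ s, f s = m) :
    ∃ (A : ∀ s, Set (Module.End.eigenspace (P : K →ₗ[ℂ] K) (f s)))
      (b : ∀ s, HilbertBasis (A s) ℂ (Module.End.eigenspace (P : K →ₗ[ℂ] K) (f s)))
      (w : HilbertBasis (Σ s, A s) ℂ K), ∀ a, w a = b a.1 a.2 := by
  let E : α → Submodule ℂ K := fun s => Module.End.eigenspace (P : K →ₗ[ℂ] K) (f s)
  have hclosed : ∀ s, IsClosed (E s : Set K) := fun s => by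
    have : (E s : Set K) = {x | P x = f s • x} := by
      ext x; exact Module.End.mem_eigenspace_iff
    rw [this]
    exact isClosed_eq P.continuous (continuous_const_smul _)
  have hcomplete : ∀ s, CompleteSpace (E s) := fun s => (hclosed s).completeSpace_coe
  choose A b hb using fun s => exists_hilbertBasis ℂ (E s)
  have hE : OrthogonalFamily ℂ (fun s => E s) fun s => (E s).subtypeₗᵢ :=
    (hsymm.orthogonalFamily_eigenspaces).comp hf
  let v : (Σ s, A s) → K := fun a => (b a.1 a.2 : E a.1)
  have hv : Orthonormal ℂ v := hE.orthonormal_sigma_orthonormal fun s => (b s).orthonormal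
  have hspan : (Submodule.span ℂ (Set.range v))ᗮ = ⊥ := by
    rw [eq_bot_iff, ← ContinuousLinearMap.orthogonalComplement_iSup_eigenspaces_eq_bot hP hsymm]
    intro x hx
    rw [← Submodule.iInf_orthogonal, Submodule.mem_iInf]
    intro m
    rcases eq_or_ne (Module.End.eigenspace (P : K →ₗ[ℂ] K) m) ⊥ with hbot | hne
    · rw [hbot, Submodule.bot_orthogonal_eq_top]; trivial
    obtain ⟨s, rfl⟩ := h m hne
    intro z hz
    -- Orthogonality to the basis vectors extends to the whole eigenspace because the kernel of `⟪x,
    -- ·⟫` is closed.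
    have hle : (Submodule.span ℂ (Set.range (b s))).topologicalClosure ≤
        (innerSL ℂ x ∘L (E s).subtypeL).ker := by
      refine Submodule.topologicalClosure_minimal _ ?_ (ContinuousLinearMap.isClosed_ker _)
      rw [Submodule.span_le]
      rintro _ ⟨i, rfl⟩
      exact Submodule.inner_left_of_mem_orthogonal
        (Submodule.subset_span (Set.mem_range_self (⟨s, i⟩ : Σ s, A s))) hx
    rw [(b s).dense_span] at hle
    have hz' : ⟪x, z⟫_ℂ = 0 := hle (Submodule.mem_top (x := (⟨z, hz⟩ : E s)))
    exact inner_eq_zero_symm.1 hz'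
  exact ⟨A, b, HilbertBasis.mkOfOrthogonalEqBot hv hspan, fun a => by
    rw [HilbertBasis.coe_mkOfOrthogonalEqBot]⟩

/-- A Hilbert basis of right singular vectors of a compact operator. -/
theorem exists_hilbertBasis_singular {T : K →L[ℂ] K} (hT : IsCompactOperator T) :
    ∃ (ι : Type u) (w : HilbertBasis ι ℂ K),
      (Pairwise fun i j => ⟪T (w i), T (w j)⟫_ℂ = 0) ∧ traceNorm T = ∑' i, ‖T (w i)‖ₑ := by
  have hP : IsCompactOperator ((ContinuousLinearMap.adjoint T).comp T : K →L[ℂ] K) :=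
    hT.clm_comp (ContinuousLinearMap.adjoint T)
  have hsymm := isSymmetric_adjoint_comp_self T
  obtain ⟨A, b, w, hw⟩ := exists_hilbertBasis_eigenspaces injective_coe_sq hP hsymm (by
    intro m hne
    obtain ⟨y, hy, hy0⟩ := Submodule.exists_mem_ne_zero_of_ne_bot hne
    have hy1 : ‖((‖y‖⁻¹ : ℝ) : ℂ) • y‖ = 1 := by
      rw [norm_smul, Complex.norm_real, norm_inv, norm_norm,
        inv_mul_cancel₀ (norm_ne_zero_iff.2 hy0)]
    exact ⟨_, (eigenvalue_adjoint_comp_self hy1 (Submodule.smul_mem _ _ hy)).symm⟩)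
  have hmem : ∀ a, w a ∈ Module.End.eigenspace
      (((ContinuousLinearMap.adjoint T).comp T : K →L[ℂ] K) : K →ₗ[ℂ] K)
        (((a.1 : ℝ) : ℂ) ^ 2) := fun a => by
    rw [hw]
    exact (b a.1 a.2).2
  have hnorm : ∀ a, ‖T (w a)‖ₑ = (a.1 : ℝ≥0∞) := fun a => by
    have h := eigenvalue_adjoint_comp_self (w.orthonormal.1 a) (hmem a)
    rw [enorm_eq_nnnorm, injective_coe_sq h]
  refine ⟨_, w, ?_, ?_⟩
  · intro i j hij
    rw [inner_apply_eigenvector (hmem j), w.orthonormal.2 hij, mul_zero]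
  rw [traceNorm, if_pos hT, sumSingularNumbers, ENNReal.tsum_sigma']
  refine tsum_congr fun s => ?_
  -- The kernel of `T*T` may be infinite-dimensional, where `finrank` defaults to `0`; the factor `s
  -- = 0` makes this harmless. For `s ≠ 0` compactness gives finite dimension, so `finrank` counts
  -- basis vectors.
  rcases eq_or_ne s 0 with rfl | hs
  · rw [ENNReal.tsum_eq_zero.2 fun i => (hnorm ⟨0, i⟩).trans ENNReal.coe_zero, ENNReal.coe_zero,
      mul_zero]
  have hfin := ContinuousLinearMap.finite_dimensional_eigenspace hP (((s : ℝ) : ℂ) ^ 2)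
      (pow_ne_zero _ (Complex.ofReal_ne_zero.2 (NNReal.coe_ne_zero.2 hs)))
  have hA : Finite (A s) := (b s).orthonormal.linearIndependent.finite
  have hAf := Fintype.ofFinite (A s)
  have hcard := Module.finrank_eq_card_basis (b s).toOrthonormalBasis.toBasis
  simp only [hnorm, tsum_fintype, Finset.sum_const, nsmul_eq_mul, Finset.card_univ]
  rw [← hcard]

/-- On the singular basis the sum of `‖T (w i)‖` is the trace norm. Orthogonality of the images
bounds it by the dual norm, and the converse bound holds for every Hilbert basis. -/
theorem traceNorm_eq_dualTraceNorm {T : K →L[ℂ] K} (hT : IsCompactOperator T) :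
    traceNorm T = dualTraceNorm T := by
  obtain ⟨ι, w, hw, h⟩ := exists_hilbertBasis_singular hT
  exact h ▸ le_antisymm (tsum_enorm_le_dualTraceNorm T w.orthonormal hw) (dualTraceNorm_le_tsum w T)

theorem isCompactOperator_of_traceNorm_ne_top {T : K →L[ℂ] K} (hT : traceNorm T ≠ ∞) :
    IsCompactOperator T := by
  by_contra h
  exact hT (if_neg h)

theorem dualTraceNorm_le_traceNorm (T : K →L[ℂ] K) : dualTraceNorm T ≤ traceNorm T := by
  by_cases hT : IsCompactOperator T
  · exact (traceNorm_eq_dualTraceNorm hT).ge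
  · rw [traceNorm, if_neg hT]
    exact le_top

theorem dualTraceNorm_comp_comp_le_traceNorm {H : Type*} [NormedAddCommGroup H]
    [InnerProductSpace ℂ H] [CompleteSpace H] (S : H →L[ℂ] H) (hS : IsCompactOperator S)
    (B : H →L[ℂ] K) (D : K →L[ℂ] H) :
    dualTraceNorm (B.comp (S.comp D)) ≤ ‖D‖ₑ * ‖B‖ₑ * traceNorm S := by
  obtain ⟨ι, w, -, h⟩ := exists_hilbertBasis_singular hS
  exact h ▸ dualTraceNorm_comp_comp_le w S B D

/-- Compact operators with finite trace norm are limits of finite rank operators. -/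
theorem exists_finiteRank_dualTraceNorm_sub_lt {T : K →L[ℂ] K} (hT : IsCompactOperator T)
    (hT' : dualTraceNorm T ≠ ∞) {ε : ℝ≥0∞} (hε : 0 < ε) :
    ∃ F : K →L[ℂ] K, FiniteDimensional ℂ (F : K →ₗ[ℂ] K).range ∧ dualTraceNorm (F - T) < ε := by
  classical
  obtain ⟨ι, w, hw, h⟩ := exists_hilbertBasis_singular hT
  rw [traceNorm_eq_dualTraceNorm hT] at h
  rw [h] at hT'
  obtain ⟨s, hs⟩ := ((ENNReal.tendsto_tsum_compl_atTop_zero hT').eventually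
    (gt_mem_nhds hε)).exists
  -- The truncation of `T` to finitely many singular vectors; the error is the tail of a convergent
  -- sum.
  let F : K →L[ℂ] K := ∑ k ∈ s, (innerSL ℂ (w k)).smulRight (T (w k))
  have hF : ∀ x, F x = ∑ k ∈ s, ⟪w k, x⟫_ℂ • T (w k) := fun x => by
    simp [F]
  refine ⟨F, ?_, ?_⟩
  · have hle : (F : K →ₗ[ℂ] K).range ≤ Submodule.span ℂ (s.image fun k => T (w k)) := by
      rintro _ ⟨x, rfl⟩
      rw [ContinuousLinearMap.coe_coe, hF]
      exact Submodule.sum_mem _ fun k hk => Submodule.smul_mem _ _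
        (Submodule.subset_span (Finset.mem_coe.2 (Finset.mem_image_of_mem _ hk)))
    exact Submodule.finiteDimensional_of_le hle
  · rw [dualTraceNorm_sub_comm]
    refine lt_of_le_of_lt (dualTraceNorm_le_tsum w _) (lt_of_eq_of_lt ?_ hs)
    have hz : ∀ k, (T - F) (w k) = if k ∈ s then 0 else T (w k) := fun k => by
      rw [sub_apply, hF]
      simp only [orthonormal_iff_ite.1 w.orthonormal, ite_smul, one_smul, zero_smul,
        Finset.sum_ite_eq']
      split_ifs <;> simp
    simp only [hz]
    refine Eq.trans ?_ (tsum_subtype {k | k ∉ s} fun k => ‖T (w k)‖ₑ).symm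
    refine tsum_congr fun k => ?_
    by_cases hk : k ∈ s <;> simp [hk, Set.indicator]

end SingularBasis

/-! ### Estimates for finite rank determinants -/

section FiniteRank

variable {K : Type*} [NormedAddCommGroup K] [InnerProductSpace ℂ K]

/-- The basis consists of eigenvectors of `f* f`, with `f` the compression of `F` to its own range;
it makes the images under `F` orthogonal. -/
theorem exists_orthonormalBasis_range (F : K →L[ℂ] K)
    [FiniteDimensional ℂ (F : K →ₗ[ℂ] K).range] :
    ∃ (n : ℕ) (v : OrthonormalBasis (Fin n) ℂ (F : K →ₗ[ℂ] K).range),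
      ∑ i, ‖F (v i)‖ₑ ≤ dualTraceNorm F := by
  let f : Module.End ℂ (F : K →ₗ[ℂ] K).range :=
    (F : K →ₗ[ℂ] K).rangeRestrict ∘ₗ (F : K →ₗ[ℂ] K).range.subtype
  have hsymm : (LinearMap.adjoint f * f).IsSymmetric := f.isSymmetric_adjoint_mul_self
  let v := hsymm.eigenvectorBasis rfl
  refine ⟨_, v, ?_⟩
  have hv : Orthonormal ℂ fun i => (v i : K) :=
    v.orthonormal.comp_linearIsometry (F : K →ₗ[ℂ] K).range.subtypeₗᵢ
  rw [← tsum_fintype (L := .unconditional _)]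
  refine tsum_enorm_le_dualTraceNorm F hv fun i j hij => ?_
  have h1 : ⟪F (v i), F (v j)⟫_ℂ = ⟪f (v i), f (v j)⟫_ℂ := rfl
  refine h1.trans ?_
  rw [← LinearMap.adjoint_inner_right]
  have h2 : LinearMap.adjoint f (f (v j)) = _ := hsymm.apply_eigenvectorBasis rfl j
  rw [h2, inner_smul_right]
  exact mul_eq_zero_of_right _ (v.orthonormal.2 hij)

/-- Hadamard's inequality in the basis above, with `1 + t ≤ exp t` in each factor. It serves both
for `g = I + F` and for its inverse. -/
theorem norm_det_le_exp_dualTraceNorm (F : K →L[ℂ] K)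
    [FiniteDimensional ℂ (F : K →ₗ[ℂ] K).range] (hF : dualTraceNorm F ≠ ∞) {a : ℝ} (ha : 0 ≤ a)
    (g : Module.End ℂ (F : K →ₗ[ℂ] K).range) (hg : ∀ x, ‖g x - x‖ ≤ a * ‖F x‖) :
    ‖LinearMap.det g‖ ≤ Real.exp (a * (dualTraceNorm F).toReal) := by
  obtain ⟨n, v, hv⟩ := exists_orthonormalBasis_range F
  have hv' : ∑ i, ‖F (v i)‖ ≤ (dualTraceNorm F).toReal := by
    have := ENNReal.toReal_mono hF hv
    rw [ENNReal.toReal_sum fun _ _ => enorm_ne_top] at this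
    simpa only [toReal_enorm] using this
  calc ‖LinearMap.det g‖ ≤ ∏ i, ‖g (v i)‖ := LinearMap.norm_det_le_prod_norm v g
    _ ≤ ∏ i, Real.exp (a * ‖F (v i)‖) := by
      refine Finset.prod_le_prod (fun _ _ => norm_nonneg _) fun i _ => ?_
      refine le_trans ?_ (Real.add_one_le_exp _)
      calc ‖g (v i)‖ ≤ ‖g (v i) - v i‖ + ‖v i‖ := norm_le_norm_sub_add _ _
        _ ≤ a * ‖F (v i)‖ + 1 := add_le_add (hg _) (v.orthonormal.1 i).le
    _ = Real.exp (a * ∑ i, ‖F (v i)‖) := by rw [← Real.exp_sum, Finset.mul_sum]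
    _ ≤ _ := Real.exp_le_exp.2 (mul_le_mul_of_nonneg_left hv' ha)

theorem norm_detOneAdd_le (F : K →L[ℂ] K) [FiniteDimensional ℂ (F : K →ₗ[ℂ] K).range]
    (hF : dualTraceNorm F ≠ ∞) : ‖detOneAdd F‖ ≤ Real.exp (dualTraceNorm F).toReal := by
  refine (norm_det_le_exp_dualTraceNorm F hF zero_le_one _ fun x => ?_).trans_eq (by rw [one_mul])
  rw [LinearMap.add_apply, Module.End.one_apply, add_sub_cancel_left, one_mul]
  rfl

/-- A lower bound for `det (I + F)` when `I + F` is bounded below. -/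
theorem exp_neg_le_norm_detOneAdd (F : K →L[ℂ] K) [FiniteDimensional ℂ (F : K →ₗ[ℂ] K).range]
    (hF : dualTraceNorm F ≠ ∞) {c : ℝ} (hc : 0 < c) (h : ∀ x, c * ‖x‖ ≤ ‖x + F x‖) :
    Real.exp (-(c⁻¹ * (dualTraceNorm F).toReal)) ≤ ‖detOneAdd F‖ := by
  set f : Module.End ℂ (F : K →ₗ[ℂ] K).range :=
    1 + (F : K →ₗ[ℂ] K).rangeRestrict ∘ₗ (F : K →ₗ[ℂ] K).range.subtype with hf
  have hfx : ∀ x, c * ‖x‖ ≤ ‖f x‖ := fun x => h x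
  have hinj : Function.Injective f := by
    rw [← LinearMap.ker_eq_bot, LinearMap.ker_eq_bot']
    intro x hx
    have := hfx x
    rw [hx, norm_zero] at this
    exact norm_le_zero_iff.1 (nonpos_of_mul_nonpos_right this hc)
  let e := LinearEquiv.ofInjectiveEndo f hinj
  have hdet : LinearMap.det f * LinearMap.det (e.symm : (F : K →ₗ[ℂ] K).range →ₗ[ℂ] (F : K →ₗ[ℂ] K).range) = 1 := by
    rw [← LinearMap.det_comp]
    have : f ∘ₗ (e.symm : (F : K →ₗ[ℂ] K).range →ₗ[ℂ] (F : K →ₗ[ℂ] K).range) = LinearMap.id := by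
      ext1 x; exact e.apply_symm_apply x
    rw [this, LinearMap.det_id]
  -- The inverse `g` of `f = I + F` satisfies `f (g x - x) = -F x`, so the lower bound for `f` gives
  -- `‖g x - x‖ ≤ c⁻¹ ‖F x‖`.
  have hle := norm_det_le_exp_dualTraceNorm F hF (inv_nonneg.2 hc.le)
    (e.symm : (F : K →ₗ[ℂ] K).range →ₗ[ℂ] (F : K →ₗ[ℂ] K).range) fun x => by
      have h1 := hfx (e.symm x - x)
      have h2 : f (e.symm x - x) = -((F : K →ₗ[ℂ] K).rangeRestrict x) := by
        rw [map_sub, show f (e.symm x) = x from e.apply_symm_apply x, hf, LinearMap.add_apply,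
          Module.End.one_apply, sub_add_cancel_left]
        rfl
      have h3 : ‖(F : K →ₗ[ℂ] K).rangeRestrict x‖ = ‖F x‖ := rfl
      rw [h2, norm_neg, h3] at h1
      rw [← div_eq_inv_mul, le_div_iff₀ hc, mul_comm]
      exact h1
  have hn := congrArg norm hdet
  rw [norm_mul, norm_one] at hn
  rw [Real.exp_neg, inv_le_iff_one_le_mul₀ (Real.exp_pos _), ← hn]
  exact mul_le_mul_of_nonneg_left hle (norm_nonneg _)

theorem finiteDimensional_range_add_smul (F G : K →L[ℂ] K) (z : ℂ)
    [FiniteDimensional ℂ (F : K →ₗ[ℂ] K).range] [FiniteDimensional ℂ (G : K →ₗ[ℂ] K).range] :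
    FiniteDimensional ℂ ((F + z • G : K →L[ℂ] K) : K →ₗ[ℂ] K).range := by
  have hle : ((F + z • G : K →L[ℂ] K) : K →ₗ[ℂ] K).range ≤
      (F : K →ₗ[ℂ] K).range ⊔ (G : K →ₗ[ℂ] K).range := by
    rintro _ ⟨x, rfl⟩
    exact Submodule.add_mem_sup ⟨x, rfl⟩ (Submodule.smul_mem _ _ ⟨x, rfl⟩)
  exact Submodule.finiteDimensional_of_le hle

/-- On the sum of the two ranges, which does not depend on `z`, the determinant is a polynomial in
`z`. -/
theorem differentiable_detOneAdd_add_smul (F G : K →L[ℂ] K)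
    [FiniteDimensional ℂ (F : K →ₗ[ℂ] K).range] [FiniteDimensional ℂ (G : K →ₗ[ℂ] K).range] :
    Differentiable ℂ fun z : ℂ => detOneAdd (F + z • G) := by
  classical
  let V : Submodule ℂ K := (F : K →ₗ[ℂ] K).range ⊔ (G : K →ₗ[ℂ] K).range
  have hF : ∀ x, (F : K →ₗ[ℂ] K) x ∈ V := fun x => Submodule.mem_sup_left ⟨x, rfl⟩
  have hG : ∀ x, (G : K →ₗ[ℂ] K) x ∈ V := fun x => Submodule.mem_sup_right ⟨x, rfl⟩
  let f : Module.End ℂ V := (F : K →ₗ[ℂ] K).codRestrict V hF ∘ₗ V.subtype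
  let g : Module.End ℂ V := (G : K →ₗ[ℂ] K).codRestrict V hG ∘ₗ V.subtype
  let b := Module.finBasis ℂ V
  have h : ∀ z : ℂ, detOneAdd (F + z • G) =
      (1 + LinearMap.toMatrix b b f + z • LinearMap.toMatrix b b g).det := fun z => by
    rw [detOneAdd_eq_det_restrict (F + z • G) V fun x => V.add_mem (hF x) (V.smul_mem z (hG x)),
      ← LinearMap.toMatrix_one b, ← map_smul, ← map_add, ← map_add, LinearMap.det_toMatrix,
      add_assoc]
    rfl
  simp only [h, Matrix.det_apply, Matrix.add_apply, Matrix.smul_apply]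
  fun_prop

/-- The Schwarz lemma for `z ↦ det (I + F + z (G - F))` on the disc of radius `b⁻¹`: there `‖z (G -
F)‖₁ ≤ 1`, so the exponential bound is uniform. The points compared are `0` and `1`; the factor `2`
bounds the oscillation around the value at `0`. -/
theorem dist_detOneAdd_le (F G : K →L[ℂ] K) [FiniteDimensional ℂ (F : K →ₗ[ℂ] K).range]
    [FiniteDimensional ℂ (G : K →ₗ[ℂ] K).range] {a b : ℝ} (hb : 0 < b) (hb' : b < 1)
    (hF : dualTraceNorm F ≤ ENNReal.ofReal a) (hFG : dualTraceNorm (G - F) ≤ ENNReal.ofReal b) :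
    dist (detOneAdd G) (detOneAdd F) ≤ 2 * Real.exp (max a 0 + 1) * b := by
  have : FiniteDimensional ℂ ((G - F : K →L[ℂ] K) : K →ₗ[ℂ] K).range := by
    have := finiteDimensional_range_add_smul G F (-1)
    rwa [neg_one_smul, ← sub_eq_add_neg] at this
  have hM : ∀ z ∈ Metric.ball (0 : ℂ) b⁻¹,
      ‖detOneAdd (F + z • (G - F))‖ ≤ Real.exp (max a 0 + 1) := fun z hz => by
    have := finiteDimensional_range_add_smul F (G - F) z
    have hle : dualTraceNorm (F + z • (G - F)) ≤ ENNReal.ofReal (max a 0 + 1) := by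
      refine (dualTraceNorm_add_le _ _).trans ?_
      rw [ENNReal.ofReal_add (le_max_right _ _) zero_le_one]
      refine add_le_add (hF.trans (ENNReal.ofReal_le_ofReal (le_max_left _ _))) ?_
      refine (dualTraceNorm_smul_le _ _).trans ?_
      refine (mul_le_mul_right hFG _).trans ?_
      rw [← ofReal_norm, ← ENNReal.ofReal_mul (norm_nonneg _)]
      refine ENNReal.ofReal_le_ofReal ?_
      rw [mem_ball_zero_iff] at hz
      calc ‖z‖ * b ≤ b⁻¹ * b := by gcongr
        _ = 1 := inv_mul_cancel₀ hb.ne'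
    refine (norm_detOneAdd_le _ (ne_top_of_le_ne_top ENNReal.ofReal_ne_top hle)).trans ?_
    exact Real.exp_le_exp.2 (ENNReal.toReal_le_of_le_ofReal (by positivity) hle)
  have h := Complex.dist_le_div_mul_dist_of_mapsTo_ball (c := 0) (R₁ := b⁻¹)
    (R₂ := 2 * Real.exp (max a 0 + 1)) (z := 1)
    (differentiable_detOneAdd_add_smul F (G - F)).differentiableOn
    (fun z hz => by
      rw [Metric.mem_closedBall, dist_eq_norm, two_mul]
      exact (norm_sub_le _ _).trans (add_le_add (hM z hz)
        (hM 0 (Metric.mem_ball_self (inv_pos.2 hb)))))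
    (by rw [mem_ball_zero_iff, norm_one]; exact (one_lt_inv₀ hb).2 hb')
  simpa [div_eq_mul_inv] using h

/-- The map `F ↦ det (I + F)` is Cauchy as `F → T` in the trace norm. -/
theorem exists_dist_detOneAdd_lt {T : K →L[ℂ] K} (hT : dualTraceNorm T ≠ ∞) {ε : ℝ}
    (hε : 0 < ε) : ∃ δ : ℝ≥0∞, 0 < δ ∧ ∀ F G : K →L[ℂ] K,
      FiniteDimensional ℂ (F : K →ₗ[ℂ] K).range → FiniteDimensional ℂ (G : K →ₗ[ℂ] K).range →
      dualTraceNorm (F - T) < δ → dualTraceNorm (G - T) < δ →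
      dist (detOneAdd G) (detOneAdd F) < ε := by
  let a : ℝ := (dualTraceNorm T).toReal + 1
  have ha : 0 ≤ a := by positivity
  let C : ℝ := 2 * Real.exp (max a 0 + 1)
  have hC : 0 < C := by positivity
  -- Approximants within `b / 2` of `T` are within `b` of each other and have norm at most `a = ‖T‖₁
  -- + 1`; `b < ε / C` makes the Lipschitz bound less than `ε`.
  obtain ⟨b, hb0, hb⟩ := exists_between (lt_min one_pos (div_pos hε hC))
  obtain ⟨hb1, hb2⟩ := lt_min_iff.1 hb
  refine ⟨ENNReal.ofReal (b / 2), ENNReal.ofReal_pos.2 (half_pos hb0), fun F G hF hG hFT hGT => ?_⟩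
  have hFa : dualTraceNorm F ≤ ENNReal.ofReal a := by
    have h := dualTraceNorm_add_le T (F - T)
    rw [add_sub_cancel] at h
    refine h.trans ?_
    rw [ENNReal.ofReal_add ENNReal.toReal_nonneg zero_le_one, ENNReal.ofReal_toReal hT]
    gcongr
    exact hFT.le.trans (ENNReal.ofReal_le_ofReal (by linarith))
  have hGF : dualTraceNorm (G - F) ≤ ENNReal.ofReal b := by
    have h := dualTraceNorm_sub_le (G - T) (F - T)
    rw [sub_sub_sub_cancel_right] at h
    refine h.trans ((add_le_add hGT.le hFT.le).trans ?_)
    rw [← ENNReal.ofReal_add (by positivity) (by positivity), add_halves]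
  refine (dist_detOneAdd_le F G hb0 hb1 hFa hGF).trans_lt ?_
  rwa [mul_comm, ← lt_div_iff₀ hC]

/-- The vector `x = F (-x)` lies in the range of `F`, so it is also a kernel vector of the
restriction. -/
theorem detOneAdd_eq_zero {F : K →L[ℂ] K} [FiniteDimensional ℂ (F : K →ₗ[ℂ] K).range]
    {x : K} (hx : x ≠ 0) (h : F x = -x) : detOneAdd F = 0 := by
  have hmem : x ∈ (F : K →ₗ[ℂ] K).range := ⟨-x, by simp [h]⟩
  by_contra hd
  have hinj := LinearMap.ker_eq_bot'.1 (LinearEquiv.ker (LinearMap.equivOfDetNeZero _ hd))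
  refine hx (congrArg Subtype.val (hinj ⟨x, hmem⟩ (Subtype.ext ?_)))
  change x + F x = 0
  rw [h, add_neg_cancel]

end FiniteRank

/-! ### The Fredholm determinant: existence, continuity, zeros -/

section Fredholm

variable {K : Type*} [NormedAddCommGroup K] [InnerProductSpace ℂ K] [CompleteSpace K]

theorem eventually_finiteRankApprox (T : K →L[ℂ] K) {δ : ℝ≥0∞} (hδ : 0 < δ) :
    ∀ᶠ F : K →L[ℂ] K in finiteRankApprox T,
      FiniteDimensional ℂ (F : K →ₗ[ℂ] K).range ∧ dualTraceNorm (F - T) < δ := by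
  refine (eventually_inf_principal.2 (Eventually.of_forall fun F hF => hF)).and ?_
  have h : ∀ᶠ F in comap (fun F => traceNorm (F - T)) (𝓝 0), traceNorm (F - T) < δ :=
    tendsto_comap.eventually (gt_mem_nhds hδ)
  exact (h.filter_mono inf_le_left).mono fun F hF => (dualTraceNorm_le_traceNorm _).trans_lt hF

theorem finiteRankApprox_neBot {T : K →L[ℂ] K} (hT : IsCompactOperator T)
    (hT' : dualTraceNorm T ≠ ∞) : (finiteRankApprox T).NeBot := by
  rw [finiteRankApprox, inf_principal_neBot_iff]
  rintro U ⟨V, hV, hVU⟩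
  obtain ⟨δ, hδ, hδV⟩ := ENNReal.nhds_zero_basis.mem_iff.1 hV
  obtain ⟨F, hF, hFT⟩ := exists_finiteRank_dualTraceNorm_sub_lt hT hT' hδ
  refine ⟨F, hVU (hδV ?_), hF⟩
  exact (traceNorm_eq_dualTraceNorm
    ((isCompactOperator_of_finiteDimensional_range F).sub hT)).trans_lt hFT

/-- The Fredholm determinant of a trace-class perturbation of the identity exists. -/
theorem hasFredholmDet_fredholmDet {S : K →L[ℂ] K} (hS : IsCompactOperator (S - 1 : K →L[ℂ] K))
    (hS' : dualTraceNorm (S - 1) ≠ ∞) : HasFredholmDet S (fredholmDet S) := by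
  have hne := finiteRankApprox_neBot hS hS'
  have h : ∃ d, HasFredholmDet S d := by
    have hc : Cauchy (map detOneAdd (finiteRankApprox (S - 1))) := by
      refine Metric.cauchy_iff.2 ⟨hne.map _, fun ε hε => ?_⟩
      obtain ⟨δ, hδ, h⟩ := exists_dist_detOneAdd_lt hS' hε
      refine ⟨_, image_mem_map (eventually_finiteRankApprox (S - 1) hδ), ?_⟩
      rintro _ ⟨F, hF, rfl⟩ _ ⟨G, hG, rfl⟩
      exact h G F hG.1 hF.1 hG.2 hF.2
    obtain ⟨d, hd⟩ := CompleteSpace.complete hc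
    exact ⟨d, hne, hd⟩
  rw [fredholmDet, dif_pos h]
  exact h.choose_spec

/-- Trace norm continuity of the determinant: finite rank operators close to `S' - 1` are also close
to `S - 1`, so the Cauchy estimate passes to the limit over pairs of approximants. -/
theorem HasFredholmDet.exists_dist_le {S : K →L[ℂ] K} {d : ℂ} (h : HasFredholmDet S d)
    (hS : dualTraceNorm (S - 1) ≠ ∞) {ε : ℝ} (hε : 0 < ε) :
    ∃ δ : ℝ≥0∞, 0 < δ ∧ ∀ (S' : K →L[ℂ] K) (d' : ℂ), HasFredholmDet S' d' →
      dualTraceNorm (S' - S) < δ → dist d' d ≤ ε := by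
  obtain ⟨δ, hδ, hdist⟩ := exists_dist_detOneAdd_lt hS hε
  refine ⟨δ / 2, ENNReal.half_pos hδ.ne', fun S' d' h' hSS' => ?_⟩
  have hne := h.1
  have hne' := h'.1
  have ht : Tendsto (fun p : (K →L[ℂ] K) × (K →L[ℂ] K) => dist (detOneAdd p.1) (detOneAdd p.2))
      (finiteRankApprox (S' - 1) ×ˢ finiteRankApprox (S - 1)) (𝓝 (dist d' d)) :=
    (h'.2.comp tendsto_fst).dist (h.2.comp tendsto_snd)
  refine le_of_tendsto ht ?_
  filter_upwards [(eventually_finiteRankApprox (S' - 1) (ENNReal.half_pos hδ.ne')).prod_mk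
    (eventually_finiteRankApprox (S - 1) hδ)] with p hp
  refine (hdist _ _ hp.2.1 hp.1.1 hp.2.2 ?_).le
  have := dualTraceNorm_add_le (p.1 - (S' - 1)) (S' - S)
  rw [show p.1 - (S' - 1) + (S' - S) = p.1 - (S - 1) by abel] at this
  refine this.trans_lt ?_
  rw [← ENNReal.add_halves δ]
  exact ENNReal.add_lt_add hp.1.2 hSS'

/-- By the Fredholm alternative an injective compact perturbation of `I` is bounded below, which
gives all nearby `det (I + F)` a common positive lower bound. -/
theorem HasFredholmDet.ne_zero {S : K →L[ℂ] K} {d : ℂ} (h : HasFredholmDet S d)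
    (hS : IsCompactOperator (S - 1 : K →L[ℂ] K)) (hS' : dualTraceNorm (S - 1) ≠ ∞)
    (hker : ∀ x, S x = 0 → x = 0) : d ≠ 0 := by
  have hne := h.1
  have hev : ¬ Module.End.HasEigenvalue ((S - 1 : K →L[ℂ] K) : Module.End ℂ K) (-1) := by
    intro hev
    obtain ⟨x, hx, hx0⟩ := hev.exists_hasEigenvector
    have h1 : S x - x = (-1 : ℂ) • x := Module.End.mem_eigenspace_iff.1 hx
    refine hx0 (hker x ?_)
    rwa [neg_one_smul, sub_eq_iff_eq_add, neg_add_cancel] at h1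
  have hanti := hS.antilipschitz_of_not_hasEigenvalue (neg_ne_zero.2 one_ne_zero) hev
  rw [antilipschitzWith_iff_exists_mul_le_norm] at hanti
  obtain ⟨c, hc, hcx⟩ := hanti
  have hSx : ∀ x, c * ‖x‖ ≤ ‖S x‖ := fun x => by simpa using hcx x
  let C : ℝ := Real.exp (-((c / 2)⁻¹ * ((dualTraceNorm (S - 1)).toReal + 1)))
  have hCd : C ≤ ‖d‖ := by
    refine ge_of_tendsto h.2.norm ?_
    -- Distance below `c / 2` preserves half of the lower bound for `S`; distance below `1` bounds
    -- the trace norm of `F` uniformly.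
    have hδ : 0 < min (ENNReal.ofReal (c / 2)) 1 :=
      lt_min (ENNReal.ofReal_pos.2 (half_pos hc)) one_pos
    filter_upwards [eventually_finiteRankApprox (S - 1) hδ] with F ⟨hF, hFS⟩
    obtain ⟨h1, h2⟩ := lt_min_iff.1 hFS
    have hle : dualTraceNorm F ≤ dualTraceNorm (S - 1) + 1 := by
      have := dualTraceNorm_add_le (S - 1) (F - (S - 1))
      rw [add_sub_cancel] at this
      exact this.trans (by gcongr)
    have htop : dualTraceNorm (S - 1) + 1 ≠ ∞ := ENNReal.add_ne_top.2 ⟨hS', ENNReal.one_ne_top⟩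
    have hFtop : dualTraceNorm F ≠ ∞ := ne_top_of_le_ne_top htop hle
    have hlow : ∀ x, c / 2 * ‖x‖ ≤ ‖x + F x‖ := fun x => by
      have h3 := norm_apply_le_dualTraceNorm (h2.trans ENNReal.one_lt_top).ne x
      have h4 : (dualTraceNorm (F - (S - 1))).toReal ≤ c / 2 :=
        ENNReal.toReal_le_of_le_ofReal (half_pos hc).le h1.le
      have h5 : S x = x + F x - (F - (S - 1)) x := by simp; abel
      have h6 : ‖S x‖ ≤ ‖x + F x‖ + ‖(F - (S - 1)) x‖ := by
        conv_lhs => rw [h5]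
        exact norm_sub_le _ _
      have h7 := hSx x
      have h8 := mul_le_mul_of_nonneg_right h4 (norm_nonneg x)
      linarith
    refine le_trans ?_ (exp_neg_le_norm_detOneAdd F hFtop (half_pos hc) hlow)
    refine Real.exp_le_exp.2 (neg_le_neg (mul_le_mul_of_nonneg_left ?_ (by positivity)))
    have := ENNReal.toReal_mono htop hle
    rwa [ENNReal.toReal_add hS' ENNReal.one_ne_top, ENNReal.toReal_one] at this
  exact norm_pos_iff.1 ((Real.exp_pos _).trans_le hCd)

theorem HasFredholmDet.eq_zero {S : K →L[ℂ] K} {d : ℂ} (h : HasFredholmDet S d)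
    (hS' : dualTraceNorm (S - 1) ≠ ∞) {x : K} (hx : x ≠ 0) (hSx : S x = 0) : d = 0 := by
  have hne := h.1
  wlog hx1 : ‖x‖ = 1 generalizing x
  · have hx' : ‖x‖ ≠ 0 := norm_ne_zero_iff.2 hx
    have h1 : ‖((‖x‖⁻¹ : ℝ) : ℂ) • x‖ = 1 := by
      rw [norm_smul, Complex.norm_real, norm_inv, norm_norm, inv_mul_cancel₀ hx']
    exact this (norm_ne_zero_iff.1 (h1 ▸ one_ne_zero)) (by rw [map_smul, hSx, smul_zero]) h1
  rw [← norm_le_zero_iff]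
  refine le_of_forall_pos_le_add fun ε hε => ?_
  rw [zero_add]
  obtain ⟨δ, hδ, hdist⟩ := exists_dist_detOneAdd_lt hS' hε
  refine le_of_tendsto h.2.norm ?_
  filter_upwards [eventually_finiteRankApprox (S - 1) (ENNReal.half_pos hδ.ne')] with F ⟨hF, hFS⟩
  -- Subtracting `Q` makes `I + F` annihilate the unit vector `x`. Since `S x = 0`, one has `x + F x
  -- = (F - (S - 1)) x`, so `Q` is as small as the approximation error.
  let Q : K →L[ℂ] K := (innerSL ℂ x).smulRight (x + F x)
  have hQ : FiniteDimensional ℂ (Q : K →ₗ[ℂ] K).range := by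
    have hle : (Q : K →ₗ[ℂ] K).range ≤ Submodule.span ℂ {x + F x} := by
      rintro _ ⟨y, rfl⟩
      exact Submodule.smul_mem _ _ (Submodule.mem_span_singleton_self _)
    exact Submodule.finiteDimensional_of_le hle
  have hG := finiteDimensional_range_add_smul F Q (-1)
  have hGx : (F + (-1 : ℂ) • Q) x = -x := by
    have : Q x = x + F x := by
      simp [Q, inner_self_eq_norm_sq_to_K, hx1]
    rw [add_apply, smul_apply, this]
    module
  have hxF : x + F x = (F - (S - 1)) x := by simp [hSx, add_comm]
  have hx1' : ‖x‖ₑ = 1 := by rw [← ofReal_norm, hx1, ENNReal.ofReal_one]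
  have hQn : dualTraceNorm Q < δ / 2 := by
    refine (dualTraceNorm_rankOne_le x (x + F x)).trans_lt ?_
    have := enorm_apply_le_dualTraceNorm (F - (S - 1)) x
    rw [hxF, hx1', one_mul]
    rw [hx1', mul_one] at this
    exact this.trans_lt hFS
  have hlt : dualTraceNorm (F + (-1 : ℂ) • Q - (S - 1)) < δ := by
    have := dualTraceNorm_sub_le (F - (S - 1)) Q
    rw [neg_one_smul, ← sub_eq_add_neg, sub_right_comm]
    refine this.trans_lt ?_
    rw [← ENNReal.add_halves δ]
    exact ENNReal.add_lt_add hFS hQn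
  have := hdist _ F hG hF hlt (hFS.trans_le ENNReal.half_le_self)
  rw [detOneAdd_eq_zero hx hGx, dist_zero_right] at this
  exact this.le

/-- The Fredholm determinant vanishes exactly when the operator is not injective. -/
theorem HasFredholmDet.eq_zero_iff {S : K →L[ℂ] K} {d : ℂ} (h : HasFredholmDet S d)
    (hS : IsCompactOperator (S - 1 : K →L[ℂ] K)) (hS' : dualTraceNorm (S - 1) ≠ ∞) :
    d = 0 ↔ ∃ x, x ≠ 0 ∧ S x = 0 := by
  refine ⟨fun hd => ?_, fun ⟨x, hx, hSx⟩ => h.eq_zero hS' hx hSx⟩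
  by_contra! hker
  exact h.ne_zero hS hS' (fun x hx => by_contra fun hx0 => hker x hx0 hx) hd

end Fredholm

/-! ### Calculus of linear and antilinear parts -/

section Parts

variable {H : Type*} [NormedAddCommGroup H] [InnerProductSpace ℂ H]

theorem linPart_apply (R : H →L[ℝ] H) (x : H) :
    linPart R x = (1 / 2 : ℂ) • (R x - Complex.I • R (Complex.I • x)) := rfl

theorem antiPart_apply (R : H →L[ℝ] H) (x : H) :
    antiPart R x = (1 / 2 : ℂ) • (R x + Complex.I • R (Complex.I • x)) := rfl

theorem linPart_add_antiPart (R : H →L[ℝ] H) (x : H) : linPart R x + antiPart R x = R x := by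
  rw [linPart_apply, antiPart_apply]
  module

theorem linPart_sub (R S : H →L[ℝ] H) : linPart (R - S) = linPart R - linPart S := by
  ext x
  simp only [linPart_apply, sub_apply]
  module

theorem antiPart_sub (R S : H →L[ℝ] H) : antiPart (R - S) = antiPart R - antiPart S := by
  ext x
  simp only [antiPart_apply, sub_apply]
  module

theorem linPart_smul (r : ℝ) (R : H →L[ℝ] H) : linPart (r • R) = (r : ℂ) • linPart R := by
  ext x
  simp only [linPart_apply, smul_apply, ← Complex.coe_smul]
  module

theorem antiPart_smul (r : ℝ) (R : H →L[ℝ] H) (x : H) :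
    antiPart (r • R) x = (r : ℂ) • antiPart R x := by
  simp only [antiPart_apply, smul_apply, ← Complex.coe_smul]
  module

theorem linPart_id : linPart (ContinuousLinearMap.id ℝ H) = ContinuousLinearMap.id ℂ H := by
  ext x
  simp only [linPart_apply, ContinuousLinearMap.id_apply, smul_smul, Complex.I_mul_I]
  module

theorem antiPart_id : antiPart (ContinuousLinearMap.id ℝ H) = 0 := by
  ext x
  simp only [antiPart_apply, ContinuousLinearMap.id_apply, smul_smul, Complex.I_mul_I]
  simp

theorem I_smul_scaleLinPart (c : ℂ) (R : H →L[ℝ] H) (x : H) :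
    Complex.I • scaleLinPart c R (Complex.I • x) = -(c • linPart R x) + antiPart R x := by
  change Complex.I • (c • linPart R (Complex.I • x) + antiPart R (Complex.I • x)) = _
  rw [map_smul, ContinuousLinearMap.map_smulₛₗ, Complex.conj_I, smul_add, smul_comm c,
    smul_smul, smul_smul, smul_smul, mul_neg, Complex.I_mul_I]
  module

theorem linPart_scaleLinPart (c : ℂ) (R : H →L[ℝ] H) :
    linPart (scaleLinPart c R) = c • linPart R := by
  ext x
  rw [linPart_apply, I_smul_scaleLinPart]
  change (1 / 2 : ℂ) • (c • linPart R x + antiPart R x - _) = _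
  rw [smul_apply]
  module

theorem antiPart_scaleLinPart (c : ℂ) (R : H →L[ℝ] H) :
    antiPart (scaleLinPart c R) = antiPart R := by
  ext x
  rw [antiPart_apply, I_smul_scaleLinPart]
  change (1 / 2 : ℂ) • (c • linPart R x + antiPart R x + _) = _
  module

theorem linPart_mem {V : Submodule ℂ H} {R : H →L[ℝ] H} (h : ∀ x, R x ∈ V) (x : H) :
    linPart R x ∈ V :=
  V.smul_mem _ (V.sub_mem (h _) (V.smul_mem _ (h _)))

theorem antiPart_mem {V : Submodule ℂ H} {R : H →L[ℝ] H} (h : ∀ x, R x ∈ V) (x : H) :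
    antiPart R x ∈ V :=
  V.smul_mem _ (V.add_mem (h _) (V.smul_mem _ (h _)))

end Parts

/-! ### Conjugation and reduction of antilinear operators to linear ones -/

section Conjugation

variable {H : Type*} [NormedAddCommGroup H] [InnerProductSpace ℂ H]

/-- Polarisation: expanding `‖x + y‖²` gives the real parts, and replacing `y` by `i y` gives the
imaginary parts with reversed sign. -/
theorem inner_conjugation (κ : H ≃ₗᵢ⋆[ℂ] H) (x y : H) : ⟪κ x, κ y⟫_ℂ = ⟪y, x⟫_ℂ := by
  have hre : ∀ x y : H, (⟪κ x, κ y⟫_ℂ).re = (⟪x, y⟫_ℂ).re := fun x y => by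
    have h1 := @norm_add_sq ℂ H _ _ _ (κ x) (κ y)
    have h2 := @norm_add_sq ℂ H _ _ _ x y
    rw [← map_add, κ.norm_map, κ.norm_map, κ.norm_map] at h1
    simp only [RCLike.re_to_complex] at h1 h2
    linarith
  apply Complex.ext
  · rw [hre, ← inner_conj_symm, Complex.conj_re]
  · have h := hre x (Complex.I • y)
    rw [map_smulₛₗ, Complex.conj_I, inner_smul_right, inner_smul_right] at h
    have hs : (⟪y, x⟫_ℂ).im = -(⟪x, y⟫_ℂ).im := by
      rw [← inner_conj_symm, Complex.conj_im]
    rw [hs]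
    simpa using h

theorem orthonormal_conjugation (κ : H ≃ₗᵢ⋆[ℂ] H) {ι : Type*} {e : ι → H}
    (he : Orthonormal ℂ e) : Orthonormal ℂ fun i => κ (e i) :=
  ⟨fun i => by rw [κ.norm_map, he.1], fun i j hij => by
    exact (inner_conjugation κ _ _).trans (he.2 hij.symm)⟩

/-- The complex linear operator `κ T κ`. -/
def conjugate (κ : H ≃ₗᵢ⋆[ℂ] H) (T : H →L[ℂ] H) : H →L[ℂ] H :=
  (κ.toContinuousLinearEquiv : H →L⋆[ℂ] H).comp
    (T.comp (κ.toContinuousLinearEquiv : H →L⋆[ℂ] H))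

theorem conjugate_apply (κ : H ≃ₗᵢ⋆[ℂ] H) (T : H →L[ℂ] H) (x : H) :
    conjugate κ T x = κ (T (κ x)) := rfl

/-- The complex linear operator `κ A`, for an antilinear operator `A`. -/
def conjComp (κ : H ≃ₗᵢ⋆[ℂ] H) (A : H →L⋆[ℂ] H) : H →L[ℂ] H :=
  (κ.toContinuousLinearEquiv : H →L⋆[ℂ] H).comp A

theorem conjComp_apply (κ : H ≃ₗᵢ⋆[ℂ] H) (A : H →L⋆[ℂ] H) (x : H) :
    conjComp κ A x = κ (A x) := rfl

theorem conjComp_sub (κ : H ≃ₗᵢ⋆[ℂ] H) (A B : H →L⋆[ℂ] H) :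
    conjComp κ (A - B) = conjComp κ A - conjComp κ B := by
  ext x
  simp [conjComp_apply]

theorem isCompactOperator_conjugate (κ : H ≃ₗᵢ⋆[ℂ] H) {T : H →L[ℂ] H}
    (hT : IsCompactOperator T) : IsCompactOperator (conjugate κ T) :=
  (hT.comp_clm (κ.toContinuousLinearEquiv : H →L⋆[ℂ] H)).clm_comp
    (κ.toContinuousLinearEquiv : H →L⋆[ℂ] H)

theorem dualTraceNorm_conjugate_le {κ : H ≃ₗᵢ⋆[ℂ] H} (hκ : ∀ x, κ (κ x) = x) (T : H →L[ℂ] H) :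
    dualTraceNorm (conjugate κ T) ≤ dualTraceNorm T := by
  refine dualTraceNorm_le fun n u v hu hv => ?_
  refine le_of_eq_of_le (Finset.sum_congr rfl fun i _ => ?_)
    (sum_le_dualTraceNorm T (orthonormal_conjugation κ hu) (orthonormal_conjugation κ hv))
  rw [conjugate_apply, ← hκ (u i), inner_conjugation, hκ, ← inner_conj_symm, RCLike.enorm_conj]

variable [CompleteSpace H]

/-- Since `κ` is antiunitary, `A* A = (κ A)* (κ A)`; the antilinear `A` and the linear `κ A` have
the same singular numbers. -/
theorem antiTraceNorm_eq_traceNorm {κ : H ≃ₗᵢ⋆[ℂ] H} (hκ : ∀ x, κ (κ x) = x)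
    (A : H →L⋆[ℂ] H) : antiTraceNorm A = traceNorm (conjComp κ A) := by
  have hc : IsCompactOperator A ↔ IsCompactOperator (conjComp κ A) := by
    refine ⟨fun h => h.clm_comp (κ.toContinuousLinearEquiv : H →L⋆[ℂ] H), fun h => ?_⟩
    have := h.clm_comp (κ.toContinuousLinearEquiv : H →L⋆[ℂ] H)
    convert! this using 1
    ext x
    exact (hκ _).symm
  have he : (antiAdjoint A).comp A =
      (ContinuousLinearMap.adjoint (conjComp κ A)).comp (conjComp κ A) := by
    ext x
    refine ext_inner_right ℂ fun y => ?_
    rw [ContinuousLinearMap.comp_apply, ContinuousLinearMap.comp_apply, inner_antiAdjoint,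
      ContinuousLinearMap.adjoint_inner_left, conjComp_apply, conjComp_apply, inner_conjugation]
  rw [antiTraceNorm, traceNorm, he]
  by_cases h : IsCompactOperator A
  · rw [if_pos h, if_pos (hc.1 h)]
  · rw [if_neg h, if_neg (mt hc.2 h)]

theorem realTraceNorm_eq {κ : H ≃ₗᵢ⋆[ℂ] H} (hκ : ∀ x, κ (κ x) = x) {R : H →L[ℝ] H}
    (hR : realTraceNorm R ≠ ∞) :
    IsCompactOperator (linPart R) ∧ IsCompactOperator (conjComp κ (antiPart R)) ∧
      realTraceNorm R = dualTraceNorm (linPart R) + dualTraceNorm (conjComp κ (antiPart R)) := by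
  rw [realTraceNorm, antiTraceNorm_eq_traceNorm hκ] at hR ⊢
  obtain ⟨h1, h2⟩ := ENNReal.add_ne_top.1 hR
  have hC := isCompactOperator_of_traceNorm_ne_top h1
  have hA := isCompactOperator_of_traceNorm_ne_top h2
  exact ⟨hC, hA, by rw [traceNorm_eq_dualTraceNorm hC, traceNorm_eq_dualTraceNorm hA]⟩

end Conjugation

/-! ### Trace norm bounds for the complexification -/

section BlockOperator

variable {H : Type*} [NormedAddCommGroup H] [InnerProductSpace ℂ H]

/-- The inclusion of the first summand. -/
def inlL : H →L[ℂ] WithLp 2 (H × H) :=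
  ((WithLp.prodContinuousLinearEquiv 2 ℂ H H).symm : (H × H) →L[ℂ] WithLp 2 (H × H)).comp
    (ContinuousLinearMap.inl ℂ H H)

/-- The inclusion of the second summand. -/
def inrL : H →L[ℂ] WithLp 2 (H × H) :=
  ((WithLp.prodContinuousLinearEquiv 2 ℂ H H).symm : (H × H) →L[ℂ] WithLp 2 (H × H)).comp
    (ContinuousLinearMap.inr ℂ H H)

/-- The block operator `[[C, κ S κ], [S, κ C κ]]` on `H ⊕ H`. -/
def blockOperator (κ : H ≃ₗᵢ⋆[ℂ] H) (C S : H →L[ℂ] H) :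
    WithLp 2 (H × H) →L[ℂ] WithLp 2 (H × H) :=
  inlL.comp (C.comp (WithLp.fstL 2 ℂ H H)) + inlL.comp ((conjugate κ S).comp (WithLp.sndL 2 ℂ H H))
    + (inrL.comp (S.comp (WithLp.fstL 2 ℂ H H)) +
      inrL.comp ((conjugate κ C).comp (WithLp.sndL 2 ℂ H H)))

theorem blockOperator_apply (κ : H ≃ₗᵢ⋆[ℂ] H) (C S : H →L[ℂ] H) (z : WithLp 2 (H × H)) :
    blockOperator κ C S z =
      WithLp.toLp 2 (C z.fst + κ (S (κ z.snd)), S z.fst + κ (C (κ z.snd))) := by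
  apply WithLp.ofLp_injective
  simp [blockOperator, inlL, inrL, conjugate_apply]

theorem blockOperator_sub (κ : H ≃ₗᵢ⋆[ℂ] H) (C S C' S' : H →L[ℂ] H) :
    blockOperator κ C S - blockOperator κ C' S' = blockOperator κ (C - C') (S - S') := by
  ext z
  rw [sub_apply, blockOperator_apply, blockOperator_apply, blockOperator_apply]
  apply WithLp.ofLp_injective
  simp only [sub_apply, map_sub, WithLp.ofLp_sub, Prod.mk_sub_mk]
  congr 1 <;> abel

theorem isCompactOperator_blockOperator (κ : H ≃ₗᵢ⋆[ℂ] H) {C S : H →L[ℂ] H}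
    (hC : IsCompactOperator C) (hS : IsCompactOperator S) :
    IsCompactOperator (blockOperator κ C S) := by
  have key : ∀ (B : H →L[ℂ] WithLp 2 (H × H)) (D : WithLp 2 (H × H) →L[ℂ] H) (T : H →L[ℂ] H),
      IsCompactOperator T → IsCompactOperator (B.comp (T.comp D)) := fun B D T hT =>
    (hT.comp_clm D).clm_comp B
  have h1 := (key inlL (WithLp.fstL 2 ℂ H H) C hC).add
    (key inlL (WithLp.sndL 2 ℂ H H) _ (isCompactOperator_conjugate κ hS))
  have h2 := (key inrL (WithLp.fstL 2 ℂ H H) S hS).add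
    (key inrL (WithLp.sndL 2 ℂ H H) _ (isCompactOperator_conjugate κ hC))
  exact h1.add h2

/-- Each of the four blocks is a product `B T D`, so the ideal property applies. Only finiteness of
the constant and its independence of `C` and `S` matter. -/
theorem exists_dualTraceNorm_blockOperator_le [CompleteSpace H] {κ : H ≃ₗᵢ⋆[ℂ] H}
    (hκ : ∀ x, κ (κ x) = x) :
    ∃ k : ℝ≥0∞, k ≠ ∞ ∧ ∀ C S : H →L[ℂ] H, IsCompactOperator C → IsCompactOperator S →
      dualTraceNorm (blockOperator κ C S) ≤ k * (dualTraceNorm C + dualTraceNorm S) := by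
  have key : ∀ (B : H →L[ℂ] WithLp 2 (H × H)) (D : WithLp 2 (H × H) →L[ℂ] H) (T : H →L[ℂ] H),
      IsCompactOperator T →
      dualTraceNorm (B.comp (T.comp D)) ≤ ‖D‖ₑ * ‖B‖ₑ * dualTraceNorm T ∧
      dualTraceNorm (B.comp ((conjugate κ T).comp D)) ≤ ‖D‖ₑ * ‖B‖ₑ * dualTraceNorm T :=
    fun B D T hT => by
      have h := dualTraceNorm_comp_comp_le_traceNorm T hT B D
      have hT' := isCompactOperator_conjugate κ hT
      have h' := dualTraceNorm_comp_comp_le_traceNorm _ hT' B D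
      rw [traceNorm_eq_dualTraceNorm hT] at h
      rw [traceNorm_eq_dualTraceNorm hT'] at h'
      exact ⟨h, h'.trans (mul_le_mul_right (dualTraceNorm_conjugate_le hκ T) _)⟩
  let P : WithLp 2 (H × H) →L[ℂ] H := WithLp.fstL 2 ℂ H H
  let Q : WithLp 2 (H × H) →L[ℂ] H := WithLp.sndL 2 ℂ H H
  let I : H →L[ℂ] WithLp 2 (H × H) := inlL
  let J : H →L[ℂ] WithLp 2 (H × H) := inrL
  refine ⟨‖P‖ₑ * ‖I‖ₑ + ‖Q‖ₑ * ‖I‖ₑ + ‖P‖ₑ * ‖J‖ₑ + ‖Q‖ₑ * ‖J‖ₑ, ?_, fun C S hC hS => ?_⟩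
  · simp only [ne_eq, ENNReal.add_eq_top, ENNReal.mul_eq_top, enorm_ne_top, and_false, false_and,
      or_false, not_false_eq_true]
  refine (dualTraceNorm_add_le _ _).trans ((add_le_add ((dualTraceNorm_add_le _ _).trans
    (add_le_add (key I P C hC).1 (key I Q S hS).2)) ((dualTraceNorm_add_le _ _).trans
    (add_le_add (key J P S hS).1 (key J Q C hC).2))).trans ?_)
  set c := dualTraceNorm C
  set s := dualTraceNorm S
  have hc : c ≤ c + s := le_self_add
  have hs : s ≤ c + s := le_add_self
  calc _ ≤ ‖P‖ₑ * ‖I‖ₑ * (c + s) + ‖Q‖ₑ * ‖I‖ₑ * (c + s) +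
        (‖P‖ₑ * ‖J‖ₑ * (c + s) + ‖Q‖ₑ * ‖J‖ₑ * (c + s)) := by gcongr
    _ = _ := by ring

theorem complexification_eq_blockOperator {κ : H ≃ₗᵢ⋆[ℂ] H} (hκ : ∀ x, κ (κ x) = x)
    (R : H →L[ℝ] H) :
    complexification κ R = blockOperator κ (linPart R) (conjComp κ (antiPart R)) := by
  ext z
  rw [blockOperator_apply, conjComp_apply, conjComp_apply, hκ]
  rfl

/-- The polar form `r⁻¹ e^{-iθ} = l⁻¹` removes `arg`, whose branch cut would otherwise obstruct
continuity. -/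
theorem charOperator_eq {κ : H ≃ₗᵢ⋆[ℂ] H} (hκ : ∀ x, κ (κ x) = x) (R : H →L[ℝ] H) (l : ℂ) :
    charOperator κ R l = 1 - blockOperator κ (l⁻¹ • linPart R)
      (((‖l‖⁻¹ : ℝ) : ℂ) • conjComp κ (antiPart R)) := by
  have h1 : linPart (ContinuousLinearMap.id ℝ H -
      ‖l‖⁻¹ • scaleLinPart (Complex.exp (-((l.arg : ℂ) * Complex.I))) R) =
      ContinuousLinearMap.id ℂ H - l⁻¹ • linPart R := by
    rw [linPart_sub, linPart_id, linPart_smul, linPart_scaleLinPart, smul_smul]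
    congr 2
    conv_rhs => rw [← Complex.norm_mul_exp_arg_mul_I l]
    rw [mul_inv, Complex.exp_neg, Complex.ofReal_inv]
  have h2 : conjComp κ (antiPart (ContinuousLinearMap.id ℝ H -
      ‖l‖⁻¹ • scaleLinPart (Complex.exp (-((l.arg : ℂ) * Complex.I))) R)) =
      0 - ((‖l‖⁻¹ : ℝ) : ℂ) • conjComp κ (antiPart R) := by
    ext x
    rw [antiPart_sub, antiPart_id, conjComp_apply, sub_apply, antiPart_smul,
      antiPart_scaleLinPart, map_sub, map_smulₛₗ, Complex.conj_ofReal]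
    simp [conjComp_apply]
  rw [charOperator, complexification_eq_blockOperator hκ, h1, h2, ← blockOperator_sub]
  congr 1
  ext z
  rw [blockOperator_apply]
  apply WithLp.ofLp_injective
  simp [hκ]
  rfl

theorem charOperator_sub_one {κ : H ≃ₗᵢ⋆[ℂ] H} (hκ : ∀ x, κ (κ x) = x) (R : H →L[ℝ] H) (l : ℂ) :
    charOperator κ R l - 1 = -blockOperator κ (l⁻¹ • linPart R)
      (((‖l‖⁻¹ : ℝ) : ℂ) • conjComp κ (antiPart R)) := by
  rw [charOperator_eq hκ, sub_sub_cancel_left]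

end BlockOperator

/-! ### Kernel vectors and eigenvectors -/

section Kernel

variable {H : Type*} [NormedAddCommGroup H] [InnerProductSpace ℂ H]

/-- Writing vectors as `(x, κ y)`, the kernel equations are symmetric in `x` and `y`. Both `x + y`
and `i (x - y)` solve the fixed point equation, the factor `i` absorbing the sign from the
antilinear part, and one of them is nonzero. -/
theorem exists_charOperator_eq_zero_iff_fixed {κ : H ≃ₗᵢ⋆[ℂ] H} (hκ : ∀ x, κ (κ x) = x)
    (R : H →L[ℝ] H) (l : ℂ) :
    (∃ z, z ≠ 0 ∧ charOperator κ R l z = 0) ↔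
      ∃ u : H, u ≠ 0 ∧ u = l⁻¹ • linPart R u + ((‖l‖⁻¹ : ℝ) : ℂ) • antiPart R u := by
  have hz : ∀ x y : H, charOperator κ R l (WithLp.toLp 2 (x, κ y)) = 0 ↔
      x = l⁻¹ • linPart R x + ((‖l‖⁻¹ : ℝ) : ℂ) • antiPart R y ∧
      y = ((‖l‖⁻¹ : ℝ) : ℂ) • antiPart R x + l⁻¹ • linPart R y := by
    intro x y
    rw [charOperator_eq hκ, sub_apply, sub_eq_zero, blockOperator_apply]
    simp only [hκ, smul_apply, conjComp_apply, map_smulₛₗ κ, Complex.conj_ofReal]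
    rw [one_apply_eq_self, (WithLp.toLp_injective 2).eq_iff, Prod.mk.injEq]
    change _ = l⁻¹ • linPart R x + ((‖l‖⁻¹ : ℝ) : ℂ) • antiPart R (κ (κ y)) ∧
      κ y = ((‖l‖⁻¹ : ℝ) : ℂ) • κ (antiPart R x) + conj l⁻¹ • κ (linPart R (κ (κ y))) ↔ _
    rw [hκ]
    refine and_congr Iff.rfl ⟨fun h => ?_, fun h => ?_⟩
    · apply κ.injective
      rw [map_add, map_smulₛₗ, map_smulₛₗ, Complex.conj_ofReal]
      simpa only [map_smulₛₗ] using h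
    · conv_lhs => rw [h]
      rw [map_add, map_smulₛₗ, map_smulₛₗ, Complex.conj_ofReal]
  constructor
  · rintro ⟨z, hz0, hz1⟩
    have hzz : z = WithLp.toLp 2 (z.fst, κ (κ z.snd)) := by rw [hκ]; rfl
    rw [hzz, hz] at hz1
    set x := z.fst
    set y := κ z.snd
    obtain ⟨hx, hy⟩ := hz1
    by_cases hs : x + y = 0
    · refine ⟨Complex.I • (x - y), ?_, ?_⟩
      · refine smul_ne_zero Complex.I_ne_zero fun hd => hz0 ?_
        have hx0 : x = 0 := by
          have : (2 : ℂ) • x = (x + y) + (x - y) := by module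
          rw [hs, hd, add_zero] at this
          exact (smul_eq_zero.1 this).resolve_left two_ne_zero
        have hy0 : y = 0 := by rwa [hx0, zero_add] at hs
        rw [hzz, hx0, hy0, map_zero]
        rfl
      · rw [map_smul, map_smulₛₗ, Complex.conj_I, map_sub, map_sub]
        linear_combination (norm := module) Complex.I • hx - Complex.I • hy
    · refine ⟨x + y, hs, ?_⟩
      rw [map_add, map_add]
      linear_combination (norm := module) hx + hy
  · rintro ⟨u, hu, h⟩
    refine ⟨WithLp.toLp 2 (u, κ u), fun h0 => hu ?_, (hz u u).2 ⟨h, by rwa [add_comm]⟩⟩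
    exact congrArg Prod.fst (congrArg WithLp.ofLp h0)

/-- Put `u = w y` with `|w| = 1` and `w² = l / ‖l‖`. After multiplication by `‖l‖ w`, the
coefficients of `y`, `C y` and `A y` are `l`, `1` and `w * conj w = 1`. -/
theorem exists_fixed_iff_exists_eigenvector (R : H →L[ℝ] H) {l : ℂ} (hl : l ≠ 0) :
    (∃ u : H, u ≠ 0 ∧ u = l⁻¹ • linPart R u + ((‖l‖⁻¹ : ℝ) : ℂ) • antiPart R u) ↔
      ∃ x : H, x ≠ 0 ∧ R x = l • x := by
  have hr : (‖l‖ : ℂ) ≠ 0 := Complex.ofReal_ne_zero.2 (norm_ne_zero_iff.2 hl)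
  obtain ⟨w, hw, hw0, hwc⟩ : ∃ w : ℂ, w * w = l * (‖l‖ : ℂ)⁻¹ ∧ w ≠ 0 ∧ conj w * w = 1 := by
    obtain ⟨w, hw⟩ := IsAlgClosed.exists_pow_nat_eq (l * (‖l‖ : ℂ)⁻¹) two_pos
    rw [pow_two] at hw
    have hn : ‖w‖ = 1 := by
      have := congrArg norm hw
      rw [norm_mul, norm_mul, norm_inv, Complex.norm_real, norm_norm,
        mul_inv_cancel₀ (norm_ne_zero_iff.2 hl)] at this
      nlinarith [norm_nonneg w]
    refine ⟨w, hw, norm_ne_zero_iff.1 (hn ▸ one_ne_zero), ?_⟩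
    rw [Complex.conj_mul', hn]
    simp
  have key : ∀ y : H, (w • y = l⁻¹ • linPart R (w • y) +
      ((‖l‖⁻¹ : ℝ) : ℂ) • antiPart R (w • y)) ↔ R y = l • y := fun y => by
    have hne : (‖l‖ : ℂ) * w ≠ 0 := mul_ne_zero hr hw0
    rw [← (smul_right_injective H hne).eq_iff]
    simp only [map_smul, map_smulₛₗ, smul_add, smul_smul]
    have e1 : (‖l‖ : ℂ) * w * w = l := by
      rw [mul_assoc, hw]; field_simp
    have e2 : (‖l‖ : ℂ) * w * (l⁻¹ * w) = 1 := by
      rw [show (‖l‖ : ℂ) * w * (l⁻¹ * w) = ‖l‖ * w * w * l⁻¹ by ring, e1, mul_inv_cancel₀ hl]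
    have e3 : (‖l‖ : ℂ) * w * (((‖l‖⁻¹ : ℝ) : ℂ) * conj w) = 1 := by
      rw [Complex.ofReal_inv, show (‖l‖ : ℂ) * w * ((‖l‖ : ℂ)⁻¹ * conj w) =
        ‖l‖ * (‖l‖ : ℂ)⁻¹ * (conj w * w) by ring, hwc, mul_inv_cancel₀ hr, one_mul]
    rw [e1, e2, e3, one_smul, one_smul, linPart_add_antiPart]
    exact eq_comm
  constructor
  · rintro ⟨u, hu, h⟩
    refine ⟨w⁻¹ • u, smul_ne_zero (inv_ne_zero hw0) hu, (key _).1 ?_⟩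
    rwa [smul_inv_smul₀ hw0]
  · rintro ⟨x, hx, h⟩
    exact ⟨w • x, smul_ne_zero hw0 hx, (key x).2 h⟩

end Kernel

/-! ### The characteristic polynomial as a determinant `det (I + F)` -/

section CharPoly

/-- Scaling by `diag(-l, -‖l‖)` on the left and `diag(1, ‖l‖ / l)` on the right relates the
matrices; these scalars multiply to `‖l‖²` for each of the `d` indices. -/
theorem det_fromBlocks_rescale {d : ℕ} (C B : Matrix (Fin d) (Fin d) ℂ) {l : ℂ} (hl : l ≠ 0) :
    (Matrix.fromBlocks (C - Matrix.scalar (Fin d) l) B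
      (B.map conj) ((C - Matrix.scalar (Fin d) l).map conj)).det =
    (‖l‖ : ℂ) ^ (2 * d) * (Matrix.fromBlocks (1 - l⁻¹ • C) (-((‖l‖ : ℂ)⁻¹ • B))
      (-((‖l‖ : ℂ)⁻¹ • B.map conj)) ((1 - l⁻¹ • C).map conj)).det := by
  have hr : (‖l‖ : ℂ) ≠ 0 := Complex.ofReal_ne_zero.2 (norm_ne_zero_iff.2 hl)
  have hc : conj l ≠ 0 := (map_ne_zero _).2 hl
  have hlc : (‖l‖ : ℂ) * ‖l‖ = l * conj l := by rw [Complex.mul_conj', pow_two]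
  have h : Matrix.fromBlocks (C - Matrix.scalar (Fin d) l) B
      (B.map conj) ((C - Matrix.scalar (Fin d) l).map conj) =
      Matrix.fromBlocks ((-l) • (1 : Matrix (Fin d) (Fin d) ℂ)) 0 0
        ((-(‖l‖ : ℂ)) • (1 : Matrix (Fin d) (Fin d) ℂ)) *
      Matrix.fromBlocks (1 - l⁻¹ • C) (-((‖l‖ : ℂ)⁻¹ • B))
        (-((‖l‖ : ℂ)⁻¹ • B.map conj)) ((1 - l⁻¹ • C).map conj) *
      Matrix.fromBlocks (1 : Matrix (Fin d) (Fin d) ℂ) 0 0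
        ((‖l‖ * l⁻¹ : ℂ) • (1 : Matrix (Fin d) (Fin d) ℂ)) := by
    rw [Matrix.fromBlocks_multiply, Matrix.fromBlocks_multiply]
    simp only [Matrix.smul_mul, one_mul, zero_mul, add_zero, zero_add, mul_one, mul_zero,
      Matrix.mul_smul]
    rw [Matrix.fromBlocks_inj]
    refine ⟨?_, ?_, ?_, ?_⟩ <;> ext i j <;>
      simp only [Matrix.sub_apply, Matrix.neg_apply, Matrix.smul_apply, smul_eq_mul,
        Matrix.scalar_apply, Matrix.diagonal_apply, Matrix.one_apply, Matrix.map_apply, map_sub,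
        map_mul, map_inv₀]
    · split_ifs <;> field_simp <;> ring
    · field_simp
    · field_simp
    · have e : (‖l‖ : ℂ) * l⁻¹ * -‖l‖ = -conj l := by
        rw [mul_neg, mul_right_comm, hlc]; field_simp
      rw [← mul_assoc, e]
      split_ifs <;> simp <;> field_simp
      ring
  rw [h, Matrix.det_mul, Matrix.det_mul, Matrix.det_fromBlocks_zero₂₁, Matrix.det_fromBlocks_zero₂₁]
  simp only [Matrix.det_smul, Matrix.det_one, mul_one, one_mul, Fintype.card_fin]
  rw [mul_right_comm, ← mul_pow, ← mul_pow, pow_mul]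
  congr 2
  field_simp

variable {H : Type*} [NormedAddCommGroup H] [InnerProductSpace ℂ H]

theorem _root_.Orthonormal.sum_inner_smul_eq_of_mem_span {ι : Type*} [Fintype ι] {e : ι → H}
    (he : Orthonormal ℂ e) {x : H} (hx : x ∈ Submodule.span ℂ (Set.range e)) :
    ∑ i, ⟪e i, x⟫_ℂ • e i = x := by
  obtain ⟨c, rfl⟩ := (Submodule.mem_span_range_iff_exists_fun ℂ).1 hx
  exact Finset.sum_congr rfl fun i _ => by rw [he.inner_right_fintype]

theorem conjugation_mem_span (κ : H ≃ₗᵢ⋆[ℂ] H) {ι : Type*} {e : ι → H} {x : H}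
    (hx : x ∈ Submodule.span ℂ (Set.range e)) :
    κ x ∈ Submodule.span ℂ (Set.range fun i => κ (e i)) := by
  induction hx using Submodule.span_induction with
  | mem y hy =>
    obtain ⟨i, rfl⟩ := hy
    exact Submodule.subset_span ⟨i, rfl⟩
  | zero => rw [map_zero]; exact Submodule.zero_mem _
  | add y z _ _ hy hz => rw [map_add]; exact Submodule.add_mem _ hy hz
  | smul c y _ hy => rw [map_smulₛₗ]; exact Submodule.smul_mem _ _ hy

/-- The characteristic polynomial of a finite rank operator as a determinant of a finite rank
perturbation of the identity. -/
theorem charPoly_eq_detOneAdd {κ : H ≃ₗᵢ⋆[ℂ] H} (hκ : ∀ x, κ (κ x) = x) {R : H →L[ℝ] H} {d : ℕ}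
    {e : Fin d → H} (he : Orthonormal ℂ e)
    (hR : ∀ x, R x ∈ Submodule.span ℂ (Set.range e)) {l : ℂ} (hl : l ≠ 0) :
    FiniteDimensional ℂ ((charOperator κ R l - 1 : WithLp 2 (H × H) →L[ℂ] WithLp 2 (H × H)) :
      WithLp 2 (H × H) →ₗ[ℂ] WithLp 2 (H × H)).range ∧
    charPoly R e l / (‖l‖ : ℂ) ^ (2 * d) = detOneAdd (charOperator κ R l - 1) := by
  have hr : (‖l‖ : ℂ) ≠ 0 := Complex.ofReal_ne_zero.2 (norm_ne_zero_iff.2 hl)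
  set F : WithLp 2 (H × H) →L[ℂ] WithLp 2 (H × H) := charOperator κ R l - 1 with hF
  have hFz : ∀ z, F z = WithLp.toLp 2
      (-(l⁻¹ • linPart R z.fst + (‖l‖ : ℂ)⁻¹ • antiPart R (κ z.snd)),
        -κ ((‖l‖ : ℂ)⁻¹ • antiPart R z.fst + l⁻¹ • linPart R (κ z.snd))) := fun z => by
    rw [hF, charOperator_eq hκ, sub_sub_cancel_left, neg_apply, blockOperator_apply]
    simp only [smul_apply, conjComp_apply, map_smulₛₗ κ, map_add, hκ, Complex.conj_ofReal,
      Complex.ofReal_inv, map_inv₀]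
    rfl
  have hκe := orthonormal_conjugation κ he
  -- `B` synthesises from the families `e` and `κ e`, and `D` takes the coefficients of `F z` in
  -- them. The range of `F` lies in their spans, so `F = B D` and the determinant moves to a matrix
  -- of size `2 d`.
  let B : (Fin d ⊕ Fin d → ℂ) →ₗ[ℂ] WithLp 2 (H × H) :=
    { toFun := fun c => WithLp.toLp 2
        (∑ i, c (Sum.inl i) • e i, ∑ i, c (Sum.inr i) • κ (e i))
      map_add' := fun c c' => by
        apply WithLp.ofLp_injective
        simp [add_smul, Finset.sum_add_distrib]
      map_smul' := fun a c => by
        apply WithLp.ofLp_injective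
        simp [mul_smul, Finset.smul_sum] }
  let D : WithLp 2 (H × H) →ₗ[ℂ] (Fin d ⊕ Fin d → ℂ) :=
    { toFun := fun z => Sum.elim (fun i => ⟪e i, (F z).fst⟫_ℂ) fun i => ⟪κ (e i), (F z).snd⟫_ℂ
      map_add' := fun z z' => by
        ext (i | i) <;> simp
      map_smul' := fun a z => by
        ext (i | i) <;> simp }
  have hfac : ∀ z, F z = B (D z) := fun z => by
    have h1 : (F z).fst ∈ Submodule.span ℂ (Set.range e) := by
      rw [hFz]
      exact Submodule.neg_mem _ (Submodule.add_mem _ (Submodule.smul_mem _ _ (linPart_mem hR _))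
        (Submodule.smul_mem _ _ (antiPart_mem hR _)))
    have h2 : (F z).snd ∈ Submodule.span ℂ (Set.range fun i => κ (e i)) := by
      rw [hFz]
      exact Submodule.neg_mem _ (conjugation_mem_span κ (Submodule.add_mem _
        (Submodule.smul_mem _ _ (antiPart_mem hR _)) (Submodule.smul_mem _ _ (linPart_mem hR _))))
    apply WithLp.ofLp_injective
    exact Prod.ext (he.sum_inner_smul_eq_of_mem_span h1).symm
      (hκe.sum_inner_smul_eq_of_mem_span h2).symm
  constructor
  · have hle : (F : WithLp 2 (H × H) →ₗ[ℂ] WithLp 2 (H × H)).range ≤ B.range := by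
      rintro _ ⟨z, rfl⟩
      exact ⟨D z, (hfac z).symm⟩
    exact Submodule.finiteDimensional_of_le hle
  rw [detOneAdd_eq_det_of_factor F B D hfac, ← LinearMap.det_toMatrix', charPoly,
    det_fromBlocks_rescale _ _ hl, mul_div_cancel_left₀ _ (pow_ne_zero _ hr)]
  have hBl : ∀ j, B (Pi.single (Sum.inl j) 1) = WithLp.toLp 2 (e j, 0) := fun j => by
    apply WithLp.ofLp_injective
    simp [B, Pi.single_apply]
  have hBr : ∀ j, B (Pi.single (Sum.inr j) 1) = WithLp.toLp 2 (0, κ (e j)) := fun j => by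
    apply WithLp.ofLp_injective
    simp [B, Pi.single_apply]
  have hDl : ∀ (c : Fin d ⊕ Fin d → ℂ) i, (D ∘ₗ B) c (Sum.inl i) = ⟪e i, (F (B c)).fst⟫_ℂ :=
    fun _ _ => rfl
  have hDr : ∀ (c : Fin d ⊕ Fin d → ℂ) i, (D ∘ₗ B) c (Sum.inr i) = ⟪κ (e i), (F (B c)).snd⟫_ℂ :=
    fun _ _ => rfl
  congr 1
  rw [map_add, LinearMap.toMatrix'_one, ← Matrix.fromBlocks_one]
  -- The conjugated blocks come from `⟪κ x, κ y⟫ = conj ⟪x, y⟫`.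
  ext (i | i) (j | j) <;>
    simp only [Matrix.add_apply, Matrix.fromBlocks_apply₁₁, Matrix.fromBlocks_apply₁₂,
      Matrix.fromBlocks_apply₂₁, Matrix.fromBlocks_apply₂₂, LinearMap.toMatrix'_apply, hDl, hDr,
      hBl, hBr, hFz, WithLp.toLp_fst, WithLp.toLp_snd, hκ, map_zero, smul_zero, add_zero, zero_add,
      inner_neg_right, inner_conjugation, inner_smul_right, inner_smul_left,
      Matrix.neg_apply, Matrix.smul_apply, Matrix.map_apply, Matrix.of_apply, smul_eq_mul,
      Matrix.zero_apply, map_inv₀, Complex.conj_ofReal, inner_conj_symm,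
      sub_eq_add_neg]
  simp [Matrix.one_apply, apply_ite]

end CharPoly

/-! ### The characteristic function -/

section CharFun

variable {H : Type*} [NormedAddCommGroup H] [InnerProductSpace ℂ H] [CompleteSpace H]

theorem isCompactOperator_charOperator_sub_one {κ : H ≃ₗᵢ⋆[ℂ] H} (hκ : ∀ x, κ (κ x) = x)
    {R : H →L[ℝ] H} (hR : IsTraceClass R) (l : ℂ) :
    IsCompactOperator (charOperator κ R l - 1 : WithLp 2 (H × H) →L[ℂ] WithLp 2 (H × H)) := by
  obtain ⟨hC, hA, -⟩ := realTraceNorm_eq hκ hR.ne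
  rw [charOperator_sub_one hκ]
  exact (isCompactOperator_blockOperator κ (hC.smul _) (hA.smul _)).neg

/-- The trace norm of a rescaled block operator is controlled by the trace norm. -/
theorem exists_dualTraceNorm_scaled_blockOperator_le {κ : H ≃ₗᵢ⋆[ℂ] H}
    (hκ : ∀ x, κ (κ x) = x) :
    ∃ k : ℝ≥0∞, k ≠ ∞ ∧ ∀ (R : H →L[ℝ] H) (a b : ℂ), IsTraceClass R →
      dualTraceNorm (blockOperator κ (a • linPart R) (b • conjComp κ (antiPart R))) ≤
        k * ((‖a‖ₑ + ‖b‖ₑ) * realTraceNorm R) := by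
  obtain ⟨k, hk, h⟩ := exists_dualTraceNorm_blockOperator_le hκ
  refine ⟨k, hk, fun R a b hR => ?_⟩
  obtain ⟨hC, hA, hn⟩ := realTraceNorm_eq hκ hR.ne
  refine (h _ _ (hC.smul a) (hA.smul b)).trans (mul_le_mul_right ?_ k)
  refine (add_le_add (dualTraceNorm_smul_le _ _) (dualTraceNorm_smul_le _ _)).trans ?_
  rw [hn, add_mul]
  gcongr
  · exact le_self_add
  · exact le_add_self

theorem dualTraceNorm_charOperator_sub_one_ne_top {κ : H ≃ₗᵢ⋆[ℂ] H} (hκ : ∀ x, κ (κ x) = x)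
    {R : H →L[ℝ] H} (hR : IsTraceClass R) (l : ℂ) :
    dualTraceNorm (charOperator κ R l - 1) ≠ ∞ := by
  obtain ⟨k, hk, h⟩ := exists_dualTraceNorm_scaled_blockOperator_le hκ
  rw [charOperator_sub_one hκ, dualTraceNorm_neg]
  exact ne_top_of_le_ne_top (ENNReal.mul_ne_top hk (ENNReal.mul_ne_top
    (ENNReal.add_ne_top.2 ⟨enorm_ne_top, enorm_ne_top⟩) hR.ne)) (h R _ _ hR)

theorem hasFredholmDet_charFun {κ : H ≃ₗᵢ⋆[ℂ] H} (hκ : ∀ x, κ (κ x) = x)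
    {R : H →L[ℝ] H} (hR : IsTraceClass R) (l : ℂ) :
    HasFredholmDet (charOperator κ R l) (charFun κ R l) :=
  hasFredholmDet_fredholmDet (isCompactOperator_charOperator_sub_one hκ hR l)
    (dualTraceNorm_charOperator_sub_one_ne_top hκ hR l)

/-- The trace norm distance of two characteristic operators is controlled by the variation of `l⁻¹`
and `‖l‖⁻¹`; continuity of the Fredholm determinant finishes. -/
theorem continuousOn_charFun {κ : H ≃ₗᵢ⋆[ℂ] H} (hκ : ∀ x, κ (κ x) = x)
    {R : H →L[ℝ] H} (hR : IsTraceClass R) : ContinuousOn (charFun κ R) {0}ᶜ := by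
  obtain ⟨k, hk, hle⟩ := exists_dualTraceNorm_scaled_blockOperator_le hκ
  intro l hl
  have hl0 : l ≠ 0 := hl
  refine ContinuousAt.continuousWithinAt ?_
  have h1 : Tendsto (fun m : ℂ => k * ((‖l⁻¹ - m⁻¹‖ₑ +
      ‖((‖l‖⁻¹ : ℝ) : ℂ) - ((‖m‖⁻¹ : ℝ) : ℂ)‖ₑ) * realTraceNorm R)) (𝓝 l) (𝓝 0) := by
    have e1 : Tendsto (fun m : ℂ => ‖l⁻¹ - m⁻¹‖ₑ) (𝓝 l) (𝓝 0) := by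
      have : ContinuousAt (fun m : ℂ => ‖l⁻¹ - m⁻¹‖ₑ) l :=
        (continuousAt_const.sub (continuousAt_inv₀ hl0)).enorm
      simpa [ContinuousAt] using this
    have e2 : Tendsto (fun m : ℂ => ‖((‖l‖⁻¹ : ℝ) : ℂ) - ((‖m‖⁻¹ : ℝ) : ℂ)‖ₑ) (𝓝 l) (𝓝 0) := by
      have : ContinuousAt (fun m : ℂ => ‖((‖l‖⁻¹ : ℝ) : ℂ) - ((‖m‖⁻¹ : ℝ) : ℂ)‖ₑ) l :=
        (continuousAt_const.sub (Complex.continuous_ofReal.continuousAt.comp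
          (continuousAt_id.norm.inv₀ (norm_ne_zero_iff.2 hl0)))).enorm
      simpa [ContinuousAt] using this
    have e3 := ENNReal.Tendsto.const_mul (a := k)
      (ENNReal.Tendsto.mul_const (b := realTraceNorm R) (e1.add e2) (Or.inr hR.ne)) (Or.inr hk)
    simpa using e3
  rw [Metric.continuousAt_iff']
  intro ε hε
  obtain ⟨δ, hδ, hdist⟩ := (hasFredholmDet_charFun hκ hR l).exists_dist_le
    (dualTraceNorm_charOperator_sub_one_ne_top hκ hR l) (half_pos hε)
  filter_upwards [h1.eventually (gt_mem_nhds hδ)] with m hm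
  refine (hdist _ _ (hasFredholmDet_charFun hκ hR m) ?_).trans_lt (half_lt_self hε)
  rw [charOperator_eq hκ, charOperator_eq hκ, sub_sub_sub_cancel_left, blockOperator_sub,
    ← sub_smul, ← sub_smul]
  exact (hle R _ _ hR).trans_lt hm

theorem charFun_eq_zero_iff {κ : H ≃ₗᵢ⋆[ℂ] H} (hκ : ∀ x, κ (κ x) = x)
    {R : H →L[ℝ] H} (hR : IsTraceClass R) {l : ℂ} (hl : l ≠ 0) :
    charFun κ R l = 0 ↔ ∃ x : H, x ≠ 0 ∧ R x = l • x := by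
  rw [(hasFredholmDet_charFun hκ hR l).eq_zero_iff (isCompactOperator_charOperator_sub_one hκ hR l)
    (dualTraceNorm_charOperator_sub_one_ne_top hκ hR l),
    exists_charOperator_eq_zero_iff_fixed hκ, exists_fixed_iff_exists_eigenvector R hl]

/-- The quotients are exact values of `detOneAdd` at finite rank operators, so it suffices that
these operators tend to `charOperator κ R l - 1` along `finiteRankApprox`. -/
theorem tendsto_charPoly {κ : H ≃ₗᵢ⋆[ℂ] H} (hκ : ∀ x, κ (κ x) = x)
    {R : H →L[ℝ] H} (hR : IsTraceClass R) {Rn : ℕ → H →L[ℝ] H} {d : ℕ → ℕ}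
    {e : ∀ n, Fin (d n) → H} (he : ∀ n, Orthonormal ℂ (e n))
    (hRn : ∀ n x, Rn n x ∈ Submodule.span ℂ (Set.range (e n)))
    (h : Tendsto (fun n => realTraceNorm (Rn n - R)) atTop (𝓝 0)) {l : ℂ} (hl : l ≠ 0) :
    Tendsto (fun n => charPoly (Rn n) (e n) l / ((‖l‖ : ℂ) ^ (2 * d n))) atTop
      (𝓝 (charFun κ R l)) := by
  obtain ⟨k, hk, hle⟩ := exists_dualTraceNorm_scaled_blockOperator_le hκ
  simp only [fun n => (charPoly_eq_detOneAdd hκ (he n) (hRn n) hl).2]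
  refine (hasFredholmDet_charFun hκ hR l).2.comp (tendsto_inf.2 ⟨tendsto_comap_iff.2 ?_,
    tendsto_principal.2 (Eventually.of_forall fun n =>
      (charPoly_eq_detOneAdd hκ (he n) (hRn n) hl).1)⟩)
  have hb : Tendsto (fun n => k * ((‖l⁻¹‖ₑ + ‖((‖l‖⁻¹ : ℝ) : ℂ)‖ₑ) * realTraceNorm (Rn n - R)))
      atTop (𝓝 0) := by
    have e3 := ENNReal.Tendsto.const_mul (a := k) (ENNReal.Tendsto.const_mul
      (a := ‖l⁻¹‖ₑ + ‖((‖l‖⁻¹ : ℝ) : ℂ)‖ₑ) h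
      (Or.inr (ENNReal.add_ne_top.2 ⟨enorm_ne_top, enorm_ne_top⟩))) (Or.inr hk)
    simpa using e3
  refine tendsto_of_tendsto_of_tendsto_of_le_of_le' tendsto_const_nhds hb
    (Eventually.of_forall fun n => zero_le) ?_
  -- The block estimate requires `Rn n - R` to be trace-class, which the convergence gives for all
  -- large `n`.
  filter_upwards [h.eventually (gt_mem_nhds ENNReal.zero_lt_top)] with n hn
  have hfin := (charPoly_eq_detOneAdd hκ (he n) (hRn n) hl).1
  have hcomp := (isCompactOperator_of_finiteDimensional_range (charOperator κ (Rn n) l - 1)).sub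
    (isCompactOperator_charOperator_sub_one hκ hR l)
  refine (traceNorm_eq_dualTraceNorm hcomp).trans_le ?_
  change dualTraceNorm (charOperator κ (Rn n) l - 1 - (charOperator κ R l - 1)) ≤ _
  rw [charOperator_sub_one hκ, charOperator_sub_one hκ, neg_sub_neg, dualTraceNorm_sub_comm,
    blockOperator_sub, ← smul_sub, ← smul_sub, ← linPart_sub, ← conjComp_sub, ← antiPart_sub]
  exact hle _ _ _ hn

end CharFun

end RealLinear
end

theorem proposition4 {H : Type*} [NormedAddCommGroup H] [InnerProductSpace ℂ H] [CompleteSpace H]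
    [TopologicalSpace.SeparableSpace H]
    (κ : H ≃ₗᵢ⋆[ℂ] H) (hκ : ∀ x, κ (κ x) = x)
    (R : H →L[ℝ] H) (hR : RealLinear.IsTraceClass R) :
    (∀ l : ℂ, l ≠ 0 →
      RealLinear.HasFredholmDet (RealLinear.charOperator κ R l) (RealLinear.charFun κ R l)) ∧
    ContinuousOn (RealLinear.charFun κ R) {0}ᶜ ∧
    (∀ l : ℂ, l ≠ 0 → (RealLinear.charFun κ R l = 0 ↔ ∃ x : H, x ≠ 0 ∧ R x = l • x)) ∧
    (∀ (Rn : ℕ → H →L[ℝ] H) (d : ℕ → ℕ) (e : ∀ n, Fin (d n) → H),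
      (∀ n, Orthonormal ℂ (e n)) →
      (∀ n, Submodule.span ℂ (Set.range (Rn n)) ≤ Submodule.span ℂ (Set.range (e n))) →
      Tendsto (fun n => RealLinear.realTraceNorm (Rn n - R)) atTop (𝓝 0) →
      ∀ l : ℂ, l ≠ 0 →
        Tendsto (fun n => RealLinear.charPoly (Rn n) (e n) l / ((‖l‖ : ℂ) ^ (2 * d n))) atTop
          (𝓝 (RealLinear.charFun κ R l))) :=
  ⟨fun l _ => RealLinear.hasFredholmDet_charFun hκ hR l, RealLinear.continuousOn_charFun hκ hR,
    fun _ hl => RealLinear.charFun_eq_zero_iff hκ hR hl,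
    fun _ _ _ he hRn h _ hl => RealLinear.tendsto_charPoly hκ hR he
      (fun n x => hRn n (Submodule.subset_span (Set.mem_range_self x))) h hl⟩
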